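/- **Lemma (Explicit formula for the random Stinespring isometry).** Let $\mathcal H_A=\mathbb C^{d_A}$, $\mathcal H_B=\mathbb C^{d_B}$, $\mathcal H_E=\mathbb C^{r}$, let $n$ be a natural number, let $\Phi:\mathcal L(\mathcal H_A)\to\mathcal L(\mathcal H_B)$ be a quantum channel and let $V:\mathcal H_A\to\mathcal H_B\otimes\mathcal H_E$ be a Stinespring isometry of $\Phi$ with environment $E$, i.e. $V^\dagger V=\mathbb 1$ and $\Phi(X)=\mathrm{Tr}_E[VXV^\dagger]$ for all $X$. Let $$\Omega(X)=\mathbb E_{U_E}\Big[\big((\mathbb 1_B\otimes U_E)V\big)^{\otimes n}\,X\,\big(V^\dagger(\mathbb 1_B\otimes U_E^\dagger)\big)^{\otimes n}\Big],\qquad X\in\mathcal L(\mathcal H_A^{\otimes n}),$$ where $U_E$ is Haar distributed on $\mathrm U(r)$ and $(\mathcal H_B\otimes\mathcal H_E)^{\otimes n}$ is identified with $\mathcal H_B^{\otimes n}\otimes\mathcal H_E^{\otimes n}$. Then, for every $X\in\mathcal L(\mathcal H_A^{\otimes n})$, $$\Omega(X)=\sum_{\sigma\in S_n}\ \sum_{\lambda\vdash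 n,\ l(\lambda)\le r}\frac1{n!}\,\frac{\dim[\lambda]}{\dim\mathcal U_{r,\lambda}}\,\Big(U_\sigma\,\Phi^{\otimes n}\big(U_\sigma^\dagger X\big)\Big)\otimes\big(U_\sigma\Pi_\lambda\big).$$ Here $U_\sigma$ denotes the unitary permuting the $n$ tensor factors according to $\sigma\in S_n$ (on $\mathcal H_A^{\otimes n}$, $\mathcal H_B^{\otimes n}$ or $\mathcal H_E^{\otimes n}$, respectively); the inner sum runs over the partitions $\lambda$ of $n$ with at most $r$ parts; $[\lambda]$ is the irreducible representation of $S_n$ labelled by $\lambda$ (the Specht module $\mathbb C[S_n]c_\lambda$, with $c_\lambda$ a Young symmetrizer of shape $\lambda$); $\mathcal U_{r,\lambda}$ is the irreducible representation of $\mathrm U(r)$ labelled by $\lambda$ (the Weyl module $c_\lambda(\mathbb C^r)^{\otimes n}$), so that $(\mathbb C^r)^{\otimes n}\cong\bigoplus_{\lambda\vdash n,\,l(\lambda)\le r}[\lambda]\otimes\mathcal U_{r,\lambda}$; and $\Pi_\lambda$ is the orthogonal projector of $\mathcal H_E^{\otimes n}$ onto the isotypic subspace $[\lambda]\otimes\mathcal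 U_{r,\lambda}$, i.e. onto the sum of all $S_n$-subrepresentations isomorphic to $[\lambda]$. -/

import Mathlib

open scoped Matrix Kronecker Nat

noncomputable section

namespace RandomStinespring

/-! ### Tensor powers

The Hilbert space `ℂ^ι` has its orthonormal basis indexed by the finite type `ι`, and the tensor
power `(ℂ^ι)^{⊗n}` has the product basis `|i₁⟩ ⊗ … ⊗ |iₙ⟩`, indexed by `i : Fin n → ι`.
Operators are written as matrices in these bases. -/

section TensorPowers

variable {ι κ : Type*}

/-- The `n`-fold tensor power `M^{⊗n}` of an operator `M : ℂ^κ → ℂ^ι`. -/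
def tensorPow (n : ℕ) (M : Matrix ι κ ℂ) : Matrix (Fin n → ι) (Fin n → κ) ℂ :=
  Matrix.of fun i j => ∏ k, M (i k) (j k)

/-- The permutation unitary `U_σ` on `(ℂ^ι)^{⊗n}`:
`U_σ (x₁ ⊗ … ⊗ xₙ) = x_{σ⁻¹(1)} ⊗ … ⊗ x_{σ⁻¹(n)}`. -/
def permUnitary (ι : Type*) [DecidableEq ι] {n : ℕ} (σ : Equiv.Perm (Fin n)) :
    Matrix (Fin n → ι) (Fin n → ι) ℂ :=
  Matrix.of fun i j => if i = j ∘ ⇑σ⁻¹ then 1 else 0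

/-- The `n`-fold tensor power `Φ^{⊗n}` of a linear map between operator spaces: the linear map
sending `|a₁⟩⟨a'₁| ⊗ … ⊗ |aₙ⟩⟨a'ₙ|` to `Φ(|a₁⟩⟨a'₁|) ⊗ … ⊗ Φ(|aₙ⟩⟨a'ₙ|)`. -/
def channelPow [Fintype κ] [DecidableEq κ] (n : ℕ) (Φ : Matrix κ κ ℂ →ₗ[ℂ] Matrix ι ι ℂ) :
    Matrix (Fin n → κ) (Fin n → κ) ℂ →ₗ[ℂ] Matrix (Fin n → ι) (Fin n → ι) ℂ where
  toFun X := Matrix.of fun b b' =>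
    ∑ a, ∑ a', X a a' * ∏ k, Φ (Matrix.single (a k) (a' k) 1) (b k) (b' k)
  map_add' X Y := by
    ext b b'
    simp [add_mul, Finset.sum_add_distrib]
  map_smul' c X := by
    ext b b'
    simp [mul_assoc, Finset.mul_sum]

end TensorPowers

/-! ### Stinespring isometries -/

section Stinespring

variable {A B E : Type*} [Fintype A] [DecidableEq A] [Fintype B] [Fintype E]

/-- Partial trace over the second tensor factor. -/
def traceRight (X : Matrix (B × E) (B × E) ℂ) : Matrix B B ℂ :=
  Matrix.of fun b b' => ∑ e, X (b, e) (b', e)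

/-- `V : ℂ^A → ℂ^B ⊗ ℂ^E` is a Stinespring isometry of `Φ`: it is an isometry and
`Φ(X) = Tr_E [V X V†]` for all operators `X`. In particular `Φ` is then a quantum channel. -/
def IsStinespringIsometry (V : Matrix (B × E) A ℂ) (Φ : Matrix A A ℂ →ₗ[ℂ] Matrix B B ℂ) : Prop :=
  Vᴴ * V = 1 ∧ ∀ X, Φ X = traceRight (V * X * Vᴴ)

end Stinespring

/-! ### Haar measure on the unitary group -/

/-- The Borel `σ`-algebra of the unitary group. -/
instance instMeasurableSpaceUnitary (r : ℕ) :
    MeasurableSpace (Matrix.unitaryGroup (Fin r) ℂ) := borel _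

instance instBorelSpaceUnitary (r : ℕ) : BorelSpace (Matrix.unitaryGroup (Fin r) ℂ) := ⟨rfl⟩

instance instCompactSpaceUnitary (r : ℕ) : CompactSpace (Matrix.unitaryGroup (Fin r) ℂ) := by
  have hK : IsCompact (Set.univ.pi fun _ : Fin r => Set.univ.pi fun _ : Fin r =>
      Metric.closedBall (0 : ℂ) 1) :=
    isCompact_univ_pi fun _ => isCompact_univ_pi fun _ => isCompact_closedBall _ _
  have hc : IsClosed ((Matrix.unitaryGroup (Fin r) ℂ : Set (Matrix (Fin r) (Fin r) ℂ))) :=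
    isClosed_unitary
  refine isCompact_iff_compactSpace.mp (hK.of_isClosed_subset hc ?_)
  intro U hU i _ j _
  simpa using entry_norm_bound_of_unitary (𝕜 := ℂ) hU i j

/-- The Haar measure on `U(r)`, normalised to be a probability measure. -/
def unitaryHaar (r : ℕ) : MeasureTheory.Measure (Matrix.unitaryGroup (Fin r) ℂ) :=
  MeasureTheory.Measure.haarMeasure ⊤

/-- The channel of `n` parallel uses of the same random Stinespring isometry,
`Ω(X) = 𝔼_U [((1 ⊗ U) V)^{⊗n} X (V† (1 ⊗ U†))^{⊗n}]`, with `U` Haar distributed on `U(r)`.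
The expectation is taken entrywise; the output lives on `B^n ⊗ E^n`, i.e. the `n` copies of `B`
are collected to the left of the `n` copies of `E`. -/
def randomStinespring {A B : Type*} [Fintype A] [Fintype B] [DecidableEq B] {r : ℕ} (n : ℕ)
    (V : Matrix (B × Fin r) A ℂ) (X : Matrix (Fin n → A) (Fin n → A) ℂ) :
    Matrix ((Fin n → B) × (Fin n → Fin r)) ((Fin n → B) × (Fin n → Fin r)) ℂ :=
  Matrix.of fun p q => ∫ U : Matrix.unitaryGroup (Fin r) ℂ,
    (tensorPow n (((1 : Matrix B B ℂ) ⊗ₖ (U : Matrix (Fin r) (Fin r) ℂ)) * V) * X *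
      tensorPow n (Vᴴ * ((1 : Matrix B B ℂ) ⊗ₖ (U : Matrix (Fin r) (Fin r) ℂ)ᴴ)))
      (fun k => (p.1 k, p.2 k)) (fun k => (q.1 k, q.2 k)) ∂(unitaryHaar r)

/-! ### Irreducible representations of the symmetric group -/

/-- The complex group algebra `ℂ[Sₙ]`. -/
abbrev SymAlgebra (n : ℕ) : Type := MonoidAlgebra ℂ (Equiv.Perm (Fin n))

/-- The Young diagram of a partition `λ` of `n`; its rows are the parts of `λ`. -/
def diagram {n : ℕ} (lam : n.Partition) : YoungDiagram :=
  YoungDiagram.ofRowLens (lam.parts.sort (· ≥ ·)) (Multiset.pairwise_sort _ _).sortedGE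

theorem card_cellsOfRowLens (w : List ℕ) :
    (YoungDiagram.cellsOfRowLens w).card = w.sum := by
  induction w with
  | nil => simp [YoungDiagram.cellsOfRowLens]
  | cons a w ih =>
    rw [YoungDiagram.cellsOfRowLens, Finset.card_union_of_disjoint, Finset.card_map, ih]
    · simp
    · rw [Finset.disjoint_left]
      rintro ⟨x, y⟩ h1 h2
      simp at h1 h2
      omega

theorem card_diagram {n : ℕ} (lam : n.Partition) : (diagram lam).cells.card = n := by
  have h : (lam.parts.sort (· ≥ ·)).sum = n := by
    rw [← Multiset.sum_coe, Multiset.sort_eq, lam.parts_sum]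
  exact (card_cellsOfRowLens _).trans h

/-- A fixed Young tableau of shape `λ`: a bijection from `{0, …, n-1}` to the cells of the Young
diagram of `λ`. (Other choices give isomorphic Specht modules.) -/
def tableau {n : ℕ} (lam : n.Partition) : Fin n ≃ (diagram lam).cells :=
  ((diagram lam).cells.equivFinOfCardEq (card_diagram lam)).symm

/-- The entry `x` lies in row `rowIdx λ x` of the tableau. -/
def rowIdx {n : ℕ} (lam : n.Partition) (x : Fin n) : ℕ := (tableau lam x).1.1

/-- The entry `x` lies in column `colIdx λ x` of the tableau. -/
def colIdx {n : ℕ} (lam : n.Partition) (x : Fin n) : ℕ := (tableau lam x).1.2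

open Classical in
/-- The row symmetrizer: the sum of all permutations that preserve the rows of the tableau. -/
def rowSymmetrizer {n : ℕ} (lam : n.Partition) : SymAlgebra n :=
  ∑ σ : Equiv.Perm (Fin n) with ∀ x, rowIdx lam (σ x) = rowIdx lam x,
    MonoidAlgebra.single σ 1

open Classical in
/-- The column antisymmetrizer: the signed sum of all permutations that preserve the columns of
the tableau. -/
def colAntisymmetrizer {n : ℕ} (lam : n.Partition) : SymAlgebra n :=
  ∑ σ : Equiv.Perm (Fin n) with ∀ x, colIdx lam (σ x) = colIdx lam x,
    MonoidAlgebra.single σ ((Equiv.Perm.sign σ : ℤ) : ℂ)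

/-- The Young symmetrizer `c_λ`. -/
def youngSymmetrizer {n : ℕ} (lam : n.Partition) : SymAlgebra n :=
  rowSymmetrizer lam * colAntisymmetrizer lam

/-- The irreducible representation `[λ]` of `Sₙ` (Specht module): the left ideal `ℂ[Sₙ] c_λ`. -/
def spechtModule {n : ℕ} (lam : n.Partition) : Submodule (SymAlgebra n) (SymAlgebra n) :=
  Submodule.span (SymAlgebra n) {youngSymmetrizer lam}

/-- `dim [λ]`. -/
def dimSpecht {n : ℕ} (lam : n.Partition) : ℕ := Module.finrank ℂ (spechtModule lam)

/-! ### The tensor power of `ℂ^r` as a representation of `Sₙ` and of `U(r)` -/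

/-- The Hilbert space `(ℂ^r)^{⊗n}`. -/
abbrev TensorSpace (n r : ℕ) : Type := EuclideanSpace ℂ (Fin n → Fin r)

/-- The representation `σ ↦ U_σ` of `Sₙ` on `(ℂ^r)^{⊗n}`. -/
def permRep (n r : ℕ) : Representation ℂ (Equiv.Perm (Fin n)) (TensorSpace n r) where
  toFun σ := Matrix.toEuclideanLin (permUnitary (Fin r) σ)
  map_one' := by
    have : permUnitary (Fin r) (1 : Equiv.Perm (Fin n)) = 1 := by
      ext i j
      simp [permUnitary, Matrix.one_apply]
    rw [this, Matrix.toLpLin_one]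
    rfl
  map_mul' σ τ := by
    have : permUnitary (Fin r) (σ * τ) = permUnitary (Fin r) σ * permUnitary (Fin r) τ := by
      ext i j
      simp [permUnitary, Matrix.mul_apply, Function.comp_assoc]
    rw [this, Matrix.toLpLin_mul_same]
    rfl

/-- The irreducible representation space `𝒰_{r,λ}` of `U(r)` (Weyl module): the image
`c_λ (ℂ^r)^{⊗n}` of the Young symmetrizer, on which `U(r)` acts by `U ↦ U^{⊗n}`. -/
def weylModule {n : ℕ} (r : ℕ) (lam : n.Partition) : Submodule ℂ (TensorSpace n r) :=
  LinearMap.range ((permRep n r).asAlgebraHom (youngSymmetrizer lam))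

/-- `dim 𝒰_{r,λ}`. -/
def dimWeyl {n : ℕ} (r : ℕ) (lam : n.Partition) : ℕ := Module.finrank ℂ (weylModule r lam)

/-- The `λ`-isotypic subspace `[λ] ⊗ 𝒰_{r,λ}` of `(ℂ^r)^{⊗n}`: the sum of all
`Sₙ`-subrepresentations isomorphic to `[λ]`. -/
def isotypicSubspace {n : ℕ} (r : ℕ) (lam : n.Partition) : Submodule ℂ (TensorSpace n r) :=
  ((isotypicComponent (SymAlgebra n) (permRep n r).asModule (spechtModule lam)).restrictScalars
    ℂ).map (permRep n r).asModuleEquiv.toLinearMap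

/-- The isotypic projector `Π_λ`: the orthogonal projector of `(ℂ^r)^{⊗n}` onto the `λ`-isotypic
subspace, as a matrix. -/
def isotypicProjector {n : ℕ} (r : ℕ) (lam : n.Partition) :
    Matrix (Fin n → Fin r) (Fin n → Fin r) ℂ :=
  Matrix.toEuclideanLin.symm (isotypicSubspace r lam).starProjection.toLinearMap

end RandomStinespring

end

noncomputable section

namespace RandomStinespring

/-! ### Combinatorics of tableaux -/

section Tableaux

variable {n : ℕ}

/-! Fix output basis states `b`, `c` on the copies of `B`. The corresponding environment block of
`Ω(X)` is the Haar twirl of the block `M` of `V^{⊗n} X (V†)^{⊗n}`, so the theorem reduces to a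
Weingarten formula for `twirl M` and to the identification of `Tr(U_σ† M)` with an entry of `U_σ
Φ^{⊗n}(U_σ† X)` (`permUnitary_mul_channelPow_apply`). The latter holds because permutations commute
with `V^{⊗n}`.

Let `G = ∑ σ, Tr(U_σ†) U_σ`. If `Z` commutes with all `U^{⊗n}`, then `Z G = ∑ σ, Tr(U_σ† Z) U_σ`
(`mul_gram_eq`): `Z` commutes with every tensor power (`commute_tensorPow`), hence by polarization
with every `∑ σ, U_σ |i⟩⟨j| U_σ†`, and the identity is a partial trace of this relation. For `Z =
twirl M` the traces equal `Tr(U_σ† M)`, so it remains to invert `G`.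

`G` is the image of a central element of `ℂ[Sₙ]`, hence a scalar on each isotypic subspace. Writing
`c_λ² = α c_λ`, the trace of right multiplication by `c_λ` on `ℂ[Sₙ]` gives `α dim [λ] = n!`, and
the scalar is the trace of `c_λ` on tensor space, namely `α dim 𝒰_{r,λ}`. The projectors come from
central idempotents, built from the sums of conjugates of `c_λ`. These sums are orthogonal by the
dominance argument on tableaux, and there are as many of them as cycle types, so the idempotents add
up to `1`; those with more than `r` parts act as zero. -/

theorem tableau_mem (lam : n.Partition) (x : Fin n) :
    (rowIdx lam x, colIdx lam x) ∈ diagram lam :=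
  (tableau lam x).2

theorem eq_of_rowIdx_eq_of_colIdx_eq (lam : n.Partition) {x y : Fin n}
    (h1 : rowIdx lam x = rowIdx lam y) (h2 : colIdx lam x = colIdx lam y) : x = y :=
  (tableau lam).injective (Subtype.ext (Prod.ext h1 h2))

theorem exists_rowIdx_colIdx (lam : n.Partition) {i j : ℕ} (h : (i, j) ∈ diagram lam) :
    ∃ x, rowIdx lam x = i ∧ colIdx lam x = j :=
  ⟨(tableau lam).symm ⟨(i, j), h⟩, by simp [rowIdx], by simp [colIdx]⟩

theorem card_rowIdx_lt_colIdx_eq (lam : n.Partition) (k j : ℕ) :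
    (Finset.univ.filter fun x => rowIdx lam x < k ∧ colIdx lam x = j).card =
      min k ((diagram lam).colLen j) := by
  rw [← Finset.card_range (min k ((diagram lam).colLen j))]
  refine Finset.card_bij (fun x _ => rowIdx lam x) ?_ ?_ ?_
  · intro x hx
    simp only [Finset.mem_filter, Finset.mem_univ, true_and] at hx
    have := YoungDiagram.mem_iff_lt_colLen.1 (tableau_mem lam x)
    rw [hx.2] at this
    simp [hx.1, this]
  · intro x hx y hy hxy
    simp only [Finset.mem_filter, Finset.mem_univ, true_and] at hx hy
    exact eq_of_rowIdx_eq_of_colIdx_eq lam hxy (hx.2.trans hy.2.symm)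
  · intro i hi
    simp only [Finset.mem_range, lt_min_iff] at hi
    obtain ⟨x, hx, hx'⟩ := exists_rowIdx_colIdx lam (YoungDiagram.mem_iff_lt_colLen.2 hi.2)
    exact ⟨x, by simp [hx, hx', hi.1], hx⟩

theorem card_colIdx_eq (lam : n.Partition) (j : ℕ) :
    (Finset.univ.filter fun x => colIdx lam x = j).card = (diagram lam).colLen j := by
  rw [← Finset.card_range ((diagram lam).colLen j)]
  refine Finset.card_bij (fun x _ => rowIdx lam x) ?_ ?_ ?_
  · intro x hx
    simp only [Finset.mem_filter, Finset.mem_univ, true_and] at hx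
    have := YoungDiagram.mem_iff_lt_colLen.1 (tableau_mem lam x)
    rw [hx] at this
    simp [this]
  · intro x hx y hy hxy
    simp only [Finset.mem_filter, Finset.mem_univ, true_and] at hx hy
    exact eq_of_rowIdx_eq_of_colIdx_eq lam hxy (hx.trans hy.symm)
  · intro i hi
    obtain ⟨x, hx, hx'⟩ := exists_rowIdx_colIdx lam
      (YoungDiagram.mem_iff_lt_colLen.2 (Finset.mem_range.1 hi))
    exact ⟨x, by simp [hx'], hx⟩

/-- If the rows `R` and the relabelled columns of `λ` meet in at most one point, then every column
has at most as many elements in the first `k` rows as the corresponding column of `λ`. -/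
theorem card_lt_col_le (lam : n.Partition) (g : Equiv.Perm (Fin n)) (R : Fin n → ℕ)
    (h : ∀ x y, R x = R y → colIdx lam (g x) = colIdx lam (g y) → x = y) (k j : ℕ) :
    (Finset.univ.filter fun x => R x < k ∧ colIdx lam (g x) = j).card ≤
      (Finset.univ.filter fun x => rowIdx lam x < k ∧ colIdx lam x = j).card := by
  rw [card_rowIdx_lt_colIdx_eq, le_min_iff]
  constructor
  · conv_rhs => rw [← Finset.card_range k]
    refine Finset.card_le_card_of_injOn R ?_ ?_
    · intro x hx
      simp only [Finset.coe_filter, Finset.mem_univ, true_and, Set.mem_ofPred_eq] at hx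
      simp [hx.1]
    · intro x hx y hy hxy
      simp only [Finset.coe_filter, Finset.mem_univ, true_and, Set.mem_ofPred_eq] at hx hy
      exact h x y hxy (hx.2.trans hy.2.symm)
  · rw [← card_colIdx_eq]
    refine Finset.card_le_card_of_injOn g ?_ g.injective.injOn
    intro x hx
    simp only [Finset.coe_filter, Finset.mem_univ, true_and, Set.mem_ofPred_eq] at hx ⊢
    exact hx.2

theorem card_lt_eq_sum (lam : n.Partition) (g : Equiv.Perm (Fin n)) (R : Fin n → ℕ) (k : ℕ) :
    (Finset.univ.filter fun x => R x < k).card =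
      ∑ j ∈ Finset.univ.image (colIdx lam),
        (Finset.univ.filter fun x => R x < k ∧ colIdx lam (g x) = j).card := by
  rw [Finset.card_eq_sum_card_fiberwise (f := fun x => colIdx lam (g x))
    (t := Finset.univ.image (colIdx lam)) (fun x _ => by simp)]
  simp only [Finset.filter_filter]

/-- Sum the column-wise bound over all columns. The counts are partial sums of row lengths, so this
says that `lam` dominates `mu`. -/
theorem card_rowIdx_lt_le (lam mu : n.Partition) (g : Equiv.Perm (Fin n))
    (h : ∀ x y, rowIdx mu x = rowIdx mu y → colIdx lam (g x) = colIdx lam (g y) → x = y)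
    (k : ℕ) :
    (Finset.univ.filter fun x => rowIdx mu x < k).card ≤
      (Finset.univ.filter fun x => rowIdx lam x < k).card := by
  rw [card_lt_eq_sum lam g, card_lt_eq_sum lam 1 (rowIdx lam)]
  exact Finset.sum_le_sum fun j _ => card_lt_col_le lam g _ h k j

theorem card_rowIdx_eq (lam : n.Partition) (i : ℕ) :
    (Finset.univ.filter fun x => rowIdx lam x = i).card = (diagram lam).rowLen i := by
  rw [← Finset.card_range ((diagram lam).rowLen i)]
  refine Finset.card_bij (fun x _ => colIdx lam x) ?_ ?_ ?_
  · intro x hx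
    simp only [Finset.mem_filter, Finset.mem_univ, true_and] at hx
    have := YoungDiagram.mem_iff_lt_rowLen.1 (tableau_mem lam x)
    rw [hx] at this
    simp [this]
  · intro x hx y hy hxy
    simp only [Finset.mem_filter, Finset.mem_univ, true_and] at hx hy
    exact eq_of_rowIdx_eq_of_colIdx_eq lam (hx.trans hy.symm) hxy
  · intro j hj
    obtain ⟨x, hx, hx'⟩ := exists_rowIdx_colIdx lam
      (YoungDiagram.mem_iff_lt_rowLen.2 (Finset.mem_range.1 hj))
    exact ⟨x, by simp [hx], hx'⟩

theorem card_lt_succ (R : Fin n → ℕ) (k : ℕ) :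
    (Finset.univ.filter fun x => R x < k + 1).card =
      (Finset.univ.filter fun x => R x < k).card +
        (Finset.univ.filter fun x => R x = k).card := by
  rw [← Finset.card_union_of_disjoint]
  · congr 1
    ext x
    simp [le_iff_lt_or_eq]
  · rw [Finset.disjoint_filter]
    intro x _ h h'
    omega

theorem rowLens_diagram (lam : n.Partition) :
    (diagram lam).rowLens = lam.parts.sort (· ≥ ·) :=
  YoungDiagram.rowLens_ofRowLens_eq_self fun _ hx =>
    lam.parts_pos ((Multiset.mem_sort _).1 hx)

theorem diagram_injective : Function.Injective (diagram : n.Partition → YoungDiagram) := by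
  intro lam mu h
  have h1 := rowLens_diagram lam
  rw [h, rowLens_diagram mu] at h1
  have h2 := congrArg (fun l : List ℕ => (l : Multiset ℕ)) h1
  simp only [Multiset.sort_eq] at h2
  exact Nat.Partition.ext h2.symm

theorem colLen_zero_diagram (lam : n.Partition) :
    (diagram lam).colLen 0 = lam.parts.card := by
  rw [← YoungDiagram.length_rowLens, rowLens_diagram, Multiset.length_sort]

theorem eq_of_card_rowIdx_lt_eq {lam mu : n.Partition}
    (h : ∀ k, (Finset.univ.filter fun x => rowIdx lam x < k).card =
      (Finset.univ.filter fun x => rowIdx mu x < k).card) : lam = mu := by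
  apply diagram_injective
  have hr : ∀ i, (diagram lam).rowLen i = (diagram mu).rowLen i := by
    intro i
    have h1 := h (i + 1)
    rw [card_lt_succ, card_lt_succ, h i, card_rowIdx_eq, card_rowIdx_eq] at h1
    omega
  apply YoungDiagram.ext
  ext ⟨i, j⟩
  rw [YoungDiagram.mem_cells, YoungDiagram.mem_cells, YoungDiagram.mem_iff_lt_rowLen,
    YoungDiagram.mem_iff_lt_rowLen, hr]

/-- If every row of `λ` meets every relabelled column of `λ` in at most one point, then the
relabelling is a product of a row permutation and a column permutation. -/
theorem exists_row_col_factorization (lam : n.Partition) (g : Equiv.Perm (Fin n))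
    (h : ∀ x y, rowIdx lam x = rowIdx lam y → colIdx lam (g x) = colIdx lam (g y) → x = y) :
    ∃ p : Equiv.Perm (Fin n), (∀ x, rowIdx lam (p x) = rowIdx lam x) ∧
      ∀ x, colIdx lam (g (p x)) = colIdx lam x := by
  have hle := card_lt_col_le lam g _ h
  -- Both families of column counts have the same total, so no inequality in `hle` is strict.
  have heq : ∀ k, ∀ j ∈ Finset.univ.image (colIdx lam),
      (Finset.univ.filter fun x => rowIdx lam x < k ∧ colIdx lam (g x) = j).card =
      (Finset.univ.filter fun x => rowIdx lam x < k ∧ colIdx lam x = j).card := by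
    intro k
    refine (Finset.sum_eq_sum_iff_of_le fun j _ => hle k j).1 ?_
    exact (card_lt_eq_sum lam g _ k).symm.trans (card_lt_eq_sum lam 1 _ k)
  have hex : ∀ x, ∃ y, rowIdx lam y = rowIdx lam x ∧ colIdx lam (g y) = colIdx lam x := by
    intro x
    by_contra! hcon
    -- Adding the row of `x` raises the count in the column of `x` for the original tableau, because
    -- of `x` itself; without a suitable `y` the relabelled count would not change.
    have h1 := heq (rowIdx lam x + 1) (colIdx lam x) (by simp)
    have h2 := heq (rowIdx lam x) (colIdx lam x) (by simp)
    have h3 : (Finset.univ.filter fun y => rowIdx lam y < rowIdx lam x + 1 ∧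
        colIdx lam (g y) = colIdx lam x) =
        Finset.univ.filter fun y => rowIdx lam y < rowIdx lam x ∧
          colIdx lam (g y) = colIdx lam x := by
      ext y
      have := hcon y
      simp only [Finset.mem_filter, Finset.mem_univ, true_and]
      constructor
      · rintro ⟨h4, h5⟩
        exact ⟨lt_of_le_of_ne (by omega) fun h6 => this h6 h5, h5⟩
      · rintro ⟨h4, h5⟩
        exact ⟨by omega, h5⟩
    rw [h3, h2] at h1
    refine absurd h1 (Finset.card_lt_card ?_).ne
    rw [Finset.ssubset_iff_of_subset]
    · exact ⟨x, by simp, by simp⟩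
    · intro y
      simp only [Finset.mem_filter, Finset.mem_univ, true_and]
      exact fun ⟨h4, h5⟩ => ⟨by omega, h5⟩
  choose p hp hp' using hex
  have hinj : Function.Injective p := by
    intro x y hxy
    exact eq_of_rowIdx_eq_of_colIdx_eq lam (by rw [← hp x, ← hp y, hxy])
      (by rw [← hp' x, ← hp' y, hxy])
  exact ⟨Equiv.ofBijective p (Finite.injective_iff_bijective.1 hinj), hp, hp'⟩

end Tableaux

/-! ### The Young symmetrizers in the group algebra -/

section GroupAlgebra

/-- If `α ≠ 0`, then `α⁻¹ • f` is a projection onto the range of `f`; if `α = 0`, then `f` is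
nilpotent. Applied to `c_λ` on the group algebra and on tensor space, this brings in `dim [λ]` and
`dim 𝒰_{r,λ}`. -/
theorem trace_eq_mul_finrank_range {M : Type*} [AddCommGroup M] [Module ℂ M]
    [FiniteDimensional ℂ M] (f : M →ₗ[ℂ] M) (α : ℂ) (h : f * f = α • f) :
    LinearMap.trace ℂ M f = α * Module.finrank ℂ (LinearMap.range f) := by
  rcases eq_or_ne α 0 with rfl | hα
  · have hn : IsNilpotent f := ⟨2, by rw [pow_two, h, zero_smul]⟩
    rw [(LinearMap.isNilpotent_trace_of_isNilpotent hn).eq_zero, zero_mul]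
  · have hp : LinearMap.IsProj (LinearMap.range f) (α⁻¹ • f) := by
      constructor
      · intro x
        exact ⟨α⁻¹ • x, by simp⟩
      · rintro _ ⟨y, rfl⟩
        have := LinearMap.congr_fun h y
        simp only [Module.End.mul_apply, LinearMap.smul_apply] at this
        rw [LinearMap.smul_apply, this, smul_smul, inv_mul_cancel₀ hα, one_smul]
    have := hp.trace
    rw [map_smul, smul_eq_mul] at this
    rw [← this, mul_inv_cancel_left₀ hα]

variable {n : ℕ}

theorem coeff_mul_eq_sum (x y : SymAlgebra n) (h : Equiv.Perm (Fin n)) :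
    (x * y).coeff h = ∑ g, x.coeff g * y.coeff (g⁻¹ * h) := by
  induction x using MonoidAlgebra.induction_linear with
  | zero => simp
  | add f g hf hg => simp [add_mul, hf, hg, Finset.sum_add_distrib]
  | single g r =>
    simp [Finsupp.single_apply]

theorem eq_sum_coeff_smul (x : SymAlgebra n) :
    x = ∑ g, x.coeff g • MonoidAlgebra.single g (1 : ℂ) := by
  ext h
  simp [MonoidAlgebra.coeff_sum]

theorem coeff_rowSymmetrizer (lam : n.Partition) (g : Equiv.Perm (Fin n))
    [Decidable (∀ x, rowIdx lam (g x) = rowIdx lam x)] :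
    (rowSymmetrizer lam).coeff g = if ∀ x, rowIdx lam (g x) = rowIdx lam x then 1 else 0 := by
  classical
  simp [rowSymmetrizer, MonoidAlgebra.coeff_sum, Finsupp.single_apply]

theorem coeff_colAntisymmetrizer (lam : n.Partition) (g : Equiv.Perm (Fin n))
    [Decidable (∀ x, colIdx lam (g x) = colIdx lam x)] :
    (colAntisymmetrizer lam).coeff g =
      if ∀ x, colIdx lam (g x) = colIdx lam x then ((Equiv.Perm.sign g : ℤ) : ℂ) else 0 := by
  classical
  simp [colAntisymmetrizer, MonoidAlgebra.coeff_sum, Finsupp.single_apply]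

theorem single_mul_rowSymmetrizer (lam : n.Partition) {p : Equiv.Perm (Fin n)}
    (hp : ∀ x, rowIdx lam (p x) = rowIdx lam x) :
    MonoidAlgebra.single p (1 : ℂ) * rowSymmetrizer lam = rowSymmetrizer lam := by
  classical
  ext h
  have : (∀ x, rowIdx lam ((p⁻¹ * h) x) = rowIdx lam x) ↔
      ∀ x, rowIdx lam (h x) = rowIdx lam x := by
    refine forall_congr' fun x => ?_
    rw [← hp ((p⁻¹ * h) x)]
    simp
  simp only [MonoidAlgebra.coeff_single_mul_apply, one_mul, coeff_rowSymmetrizer, this]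

theorem rowSymmetrizer_mul_single (lam : n.Partition) {p : Equiv.Perm (Fin n)}
    (hp : ∀ x, rowIdx lam (p x) = rowIdx lam x) :
    rowSymmetrizer lam * MonoidAlgebra.single p (1 : ℂ) = rowSymmetrizer lam := by
  classical
  ext h
  have : (∀ x, rowIdx lam ((h * p⁻¹) x) = rowIdx lam x) ↔
      ∀ x, rowIdx lam (h x) = rowIdx lam x := by
    rw [← p.forall_congr_right]
    refine forall_congr' fun x => ?_
    rw [hp x]
    simp
  simp only [MonoidAlgebra.coeff_mul_single_apply, mul_one, coeff_rowSymmetrizer, this]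

theorem single_mul_colAntisymmetrizer (lam : n.Partition) {q : Equiv.Perm (Fin n)}
    (hq : ∀ x, colIdx lam (q x) = colIdx lam x) :
    MonoidAlgebra.single q (1 : ℂ) * colAntisymmetrizer lam =
      ((Equiv.Perm.sign q : ℤ) : ℂ) • colAntisymmetrizer lam := by
  classical
  ext h
  have : (∀ x, colIdx lam ((q⁻¹ * h) x) = colIdx lam x) ↔
      ∀ x, colIdx lam (h x) = colIdx lam x := by
    refine forall_congr' fun x => ?_
    rw [← hq ((q⁻¹ * h) x)]
    simp
  simp only [MonoidAlgebra.coeff_single_mul_apply, one_mul, coeff_colAntisymmetrizer, this,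
    MonoidAlgebra.coeff_smul_apply]
  simp

theorem colAntisymmetrizer_mul_single (lam : n.Partition) {q : Equiv.Perm (Fin n)}
    (hq : ∀ x, colIdx lam (q x) = colIdx lam x) :
    colAntisymmetrizer lam * MonoidAlgebra.single q (1 : ℂ) =
      ((Equiv.Perm.sign q : ℤ) : ℂ) • colAntisymmetrizer lam := by
  classical
  ext h
  have : (∀ x, colIdx lam ((h * q⁻¹) x) = colIdx lam x) ↔
      ∀ x, colIdx lam (h x) = colIdx lam x := by
    rw [← q.forall_congr_right]
    refine forall_congr' fun x => ?_
    rw [hq x]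
    simp
  simp only [MonoidAlgebra.coeff_mul_single_apply, mul_one, coeff_colAntisymmetrizer, this,
    MonoidAlgebra.coeff_smul_apply]
  simp [mul_comm]

theorem apply_swap_eq {β : Type*} (f : Fin n → β) {x y : Fin n} (h : f x = f y) (z : Fin n) :
    f (Equiv.swap x y z) = f z := by
  rcases eq_or_ne z x with rfl | hx
  · simp [h]
  rcases eq_or_ne z y with rfl | hy
  · simp [h]
  rw [Equiv.swap_apply_of_ne_of_ne hx hy]

theorem eq_zero_of_eq_neg {x : SymAlgebra n} (h : x = -x) : x = 0 := by
  ext g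
  have := congrArg (fun y : SymAlgebra n => y.coeff g) h
  exact self_eq_neg.1 this

/-- The row symmetrizer absorbs the swap of `x` and `y`. Moved past `g` it becomes the swap of `g x`
and `g y`, which the column antisymmetrizer absorbs with sign `-1`. -/
theorem colAntisymmetrizer_mul_single_mul_rowSymmetrizer_eq_zero (lam mu : n.Partition)
    (g : Equiv.Perm (Fin n)) {x y : Fin n} (hxy : x ≠ y) (hr : rowIdx mu x = rowIdx mu y)
    (hc : colIdx lam (g x) = colIdx lam (g y)) :
    colAntisymmetrizer lam * MonoidAlgebra.single g (1 : ℂ) * rowSymmetrizer mu = 0 := by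
  apply eq_zero_of_eq_neg
  conv_lhs => rw [← single_mul_rowSymmetrizer mu (apply_swap_eq (rowIdx mu) hr), mul_assoc,
    ← mul_assoc (MonoidAlgebra.single g (1 : ℂ)), MonoidAlgebra.single_mul_single,
    Equiv.mul_swap_eq_swap_mul, ← MonoidAlgebra.single_mul_single, ← mul_assoc, ← mul_assoc,
    colAntisymmetrizer_mul_single lam (apply_swap_eq (colIdx lam) hc),
    Equiv.Perm.sign_swap (g.injective.ne hxy)]
  simp

theorem rowSymmetrizer_mul_single_mul_colAntisymmetrizer_eq_zero (lam mu : n.Partition)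
    (g : Equiv.Perm (Fin n)) {x y : Fin n} (hxy : x ≠ y) (hr : rowIdx mu x = rowIdx mu y)
    (hc : colIdx lam (g⁻¹ x) = colIdx lam (g⁻¹ y)) :
    rowSymmetrizer mu * MonoidAlgebra.single g (1 : ℂ) * colAntisymmetrizer lam = 0 := by
  apply eq_zero_of_eq_neg
  have h1 : Equiv.swap x y * g = g * Equiv.swap (g⁻¹ x) (g⁻¹ y) := by
    rw [Equiv.mul_swap_eq_swap_mul]
    simp
  conv_lhs => rw [← rowSymmetrizer_mul_single mu (apply_swap_eq (rowIdx mu) hr),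
    mul_assoc (rowSymmetrizer mu), MonoidAlgebra.single_mul_single, h1,
    ← MonoidAlgebra.single_mul_single, ← mul_assoc, mul_assoc,
    single_mul_colAntisymmetrizer lam (apply_swap_eq (colIdx lam) hc),
    Equiv.Perm.sign_swap ((g⁻¹).injective.ne hxy)]
  simp

theorem eq_zero_of_forall_single {M : Type*} [AddCommMonoid M] [Module ℂ M]
    (f : SymAlgebra n →ₗ[ℂ] M) (h : ∀ g, f (MonoidAlgebra.single g 1) = 0) (x : SymAlgebra n) :
    f x = 0 := by
  rw [eq_sum_coeff_smul x, map_sum]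
  simp [-MonoidAlgebra.smul_single, h]

/-- A nonzero product contains a nonzero row–column factor and a nonzero column–row factor. Each
forbids a repeated pair in a row and a relabelled column, so each partition dominates the other. -/
theorem youngSymmetrizer_mul_mul_youngSymmetrizer_of_ne {lam mu : n.Partition} (hne : lam ≠ mu)
    (y : SymAlgebra n) : youngSymmetrizer lam * y * youngSymmetrizer mu = 0 := by
  by_contra hcon
  apply hne
  refine eq_of_card_rowIdx_lt_eq fun k => le_antisymm ?_ ?_
  · have h1 : ∃ g : Equiv.Perm (Fin n),
        rowSymmetrizer lam * MonoidAlgebra.single g (1 : ℂ) * colAntisymmetrizer mu ≠ 0 := by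
      by_contra! h
      refine hcon ?_
      have := eq_zero_of_forall_single (LinearMap.mulLeft ℂ (rowSymmetrizer lam) ∘ₗ
        LinearMap.mulRight ℂ (colAntisymmetrizer mu)) (fun g => by simpa [mul_assoc] using h g)
        (colAntisymmetrizer lam * y * rowSymmetrizer mu)
      simpa [youngSymmetrizer, mul_assoc] using this
    obtain ⟨g, hg⟩ := h1
    refine card_rowIdx_lt_le mu lam g⁻¹ (fun x y hr hc => ?_) k
    by_contra hxy
    exact hg (rowSymmetrizer_mul_single_mul_colAntisymmetrizer_eq_zero mu lam g hxy hr hc)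
  · have h1 : ∃ g : Equiv.Perm (Fin n),
        colAntisymmetrizer lam * MonoidAlgebra.single g (1 : ℂ) * rowSymmetrizer mu ≠ 0 := by
      by_contra! h
      refine hcon ?_
      have := eq_zero_of_forall_single (LinearMap.mulLeft ℂ (colAntisymmetrizer lam) ∘ₗ
        LinearMap.mulRight ℂ (rowSymmetrizer mu)) (fun g => by simpa [mul_assoc] using h g) y
      have h2 : colAntisymmetrizer lam * (y * rowSymmetrizer mu) = 0 := by simpa using this
      calc _ = rowSymmetrizer lam * (colAntisymmetrizer lam * (y * rowSymmetrizer mu)) *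
            colAntisymmetrizer mu := by simp only [youngSymmetrizer, mul_assoc]
        _ = 0 := by rw [h2]; simp
    obtain ⟨g, hg⟩ := h1
    refine card_rowIdx_lt_le lam mu g (fun x y hr hc => ?_) k
    by_contra hxy
    exact hg (colAntisymmetrizer_mul_single_mul_rowSymmetrizer_eq_zero lam mu g hxy hr hc)

/-- For a group element `g`, either `g = p q` with `p` preserving rows and `q` preserving columns,
and both factors are absorbed up to sign, or some transposition makes the product vanish. -/
theorem exists_row_mul_col_eq_smul (lam : n.Partition) (y : SymAlgebra n) :
    ∃ t : ℂ, rowSymmetrizer lam * y * colAntisymmetrizer lam = t • youngSymmetrizer lam := by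
  induction y using MonoidAlgebra.induction_linear with
  | zero => exact ⟨0, by simp⟩
  | add f g hf hg =>
    obtain ⟨t, ht⟩ := hf
    obtain ⟨u, hu⟩ := hg
    exact ⟨t + u, by rw [mul_add, add_mul, ht, hu, add_smul]⟩
  | single g r =>
    by_cases h : ∀ x y, rowIdx lam x = rowIdx lam y →
        colIdx lam (g⁻¹ x) = colIdx lam (g⁻¹ y) → x = y
    · obtain ⟨p, hp, hq⟩ := exists_row_col_factorization lam g⁻¹ h
      refine ⟨r * ((Equiv.Perm.sign (p⁻¹ * g) : ℤ) : ℂ), ?_⟩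
      have hq' : ∀ x, colIdx lam ((p⁻¹ * g) x) = colIdx lam x := by
        intro x
        rw [← hq]
        simp
      have h1 : MonoidAlgebra.single g r = r • (MonoidAlgebra.single p (1 : ℂ) *
          MonoidAlgebra.single (p⁻¹ * g) (1 : ℂ)) := by
        simp [MonoidAlgebra.single_mul_single]
      rw [h1, mul_smul_comm, smul_mul_assoc, ← mul_assoc, rowSymmetrizer_mul_single lam hp,
        mul_assoc, single_mul_colAntisymmetrizer lam hq', mul_smul_comm, smul_smul]
      rfl
    · push Not at h
      obtain ⟨x, y, hr, hc, hxy⟩ := h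
      refine ⟨0, ?_⟩
      have h1 : MonoidAlgebra.single g r = r • MonoidAlgebra.single g (1 : ℂ) := by simp
      rw [h1, mul_smul_comm, smul_mul_assoc,
        rowSymmetrizer_mul_single_mul_colAntisymmetrizer_eq_zero lam lam g hxy hr hc]
      simp

theorem exists_youngSymmetrizer_mul_mul (lam : n.Partition) (y : SymAlgebra n) :
    ∃ t : ℂ, youngSymmetrizer lam * y * youngSymmetrizer lam = t • youngSymmetrizer lam := by
  obtain ⟨t, ht⟩ := exists_row_mul_col_eq_smul lam
    (colAntisymmetrizer lam * y * rowSymmetrizer lam)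
  exact ⟨t, by rw [← ht]; simp only [youngSymmetrizer, mul_assoc]⟩

/-- Only the identity preserves both rows and columns, so the identity arises from a single pair of
factors. -/
theorem coeff_one_youngSymmetrizer (lam : n.Partition) : (youngSymmetrizer lam).coeff 1 = 1 := by
  classical
  rw [youngSymmetrizer, coeff_mul_eq_sum, Finset.sum_eq_single 1]
  · simp [coeff_rowSymmetrizer, coeff_colAntisymmetrizer]
  · intro g _ hg
    simp only [coeff_rowSymmetrizer, coeff_colAntisymmetrizer, mul_one]
    by_cases h1 : ∀ x, rowIdx lam (g x) = rowIdx lam x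
    · rw [if_pos h1, if_neg, mul_zero]
      intro h2
      apply hg
      ext x
      have h3 := h2 (g x)
      rw [Equiv.Perm.inv_def, Equiv.symm_apply_apply] at h3
      rw [eq_of_rowIdx_eq_of_colIdx_eq lam (h1 x) h3.symm, Equiv.Perm.one_apply]
    · rw [if_neg h1, zero_mul]
  · simp

theorem star_coeff_youngSymmetrizer (lam : n.Partition) (g : Equiv.Perm (Fin n)) :
    star ((youngSymmetrizer lam).coeff g) = (youngSymmetrizer lam).coeff g := by
  classical
  rw [youngSymmetrizer, coeff_mul_eq_sum, star_sum]
  refine Finset.sum_congr rfl fun h _ => ?_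
  rw [coeff_rowSymmetrizer, coeff_colAntisymmetrizer]
  split_ifs <;> simp

theorem trace_mulRight (x : SymAlgebra n) :
    LinearMap.trace ℂ _ (LinearMap.mulRight ℂ x) = (n ! : ℂ) * x.coeff 1 := by
  rw [LinearMap.trace_eq_matrix_trace ℂ (MonoidAlgebra.basis (Equiv.Perm (Fin n)) ℂ),
    Matrix.trace]
  have : ∀ g, (LinearMap.toMatrix (MonoidAlgebra.basis (Equiv.Perm (Fin n)) ℂ)
      (MonoidAlgebra.basis (Equiv.Perm (Fin n)) ℂ) (LinearMap.mulRight ℂ x)).diag g =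
        x.coeff 1 := by
    intro g
    rw [Matrix.diag_apply, LinearMap.toMatrix_apply, MonoidAlgebra.basis_apply]
    change (MonoidAlgebra.single g (1 : ℂ) * x).coeff g = _
    simp
  rw [Finset.sum_congr rfl fun g _ => this g]
  simp [Fintype.card_perm]

theorem restrictScalars_spechtModule (lam : n.Partition) :
    (spechtModule lam).restrictScalars ℂ =
      LinearMap.range (LinearMap.mulRight ℂ (youngSymmetrizer lam)) := by
  ext x
  simp [spechtModule, Submodule.mem_span_singleton]

/-- Right multiplication by `c_λ` has the Specht module as range and trace `n!`, since the
coefficient of `c_λ` at the identity is `1`. -/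
theorem exists_youngSymmetrizer_mul_self (lam : n.Partition) :
    ∃ α : ℂ, youngSymmetrizer lam * youngSymmetrizer lam = α • youngSymmetrizer lam ∧
      α * dimSpecht lam = n ! := by
  obtain ⟨α, hα⟩ := exists_youngSymmetrizer_mul_mul lam 1
  rw [mul_one] at hα
  refine ⟨α, hα, ?_⟩
  have h := trace_eq_mul_finrank_range (LinearMap.mulRight ℂ (youngSymmetrizer lam)) α
    (by
      refine LinearMap.ext fun x => ?_
      simp only [Module.End.mul_apply, LinearMap.mulRight_apply, LinearMap.smul_apply, mul_assoc,
        hα, mul_smul_comm])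
  rw [trace_mulRight, coeff_one_youngSymmetrizer, mul_one, ← restrictScalars_spechtModule] at h
  exact h.symm

end GroupAlgebra

/-! ### Central idempotents -/

section Central

variable {n : ℕ}

/-- The sum of all conjugates of the Young symmetrizer `c_λ`. -/
def youngCentral (lam : n.Partition) : SymAlgebra n :=
  ∑ g : Equiv.Perm (Fin n), MonoidAlgebra.single g (1 : ℂ) * youngSymmetrizer lam *
    MonoidAlgebra.single g⁻¹ (1 : ℂ)

theorem coeff_youngCentral (lam : n.Partition) (h : Equiv.Perm (Fin n)) :
    (youngCentral lam).coeff h = ∑ g, (youngSymmetrizer lam).coeff (g⁻¹ * h * g) := by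
  simp [youngCentral, MonoidAlgebra.coeff_sum, mul_assoc]

theorem coeff_one_youngCentral (lam : n.Partition) : (youngCentral lam).coeff 1 = n ! := by
  simp [coeff_youngCentral, coeff_one_youngSymmetrizer, Fintype.card_perm]

theorem star_coeff_youngCentral (lam : n.Partition) (h : Equiv.Perm (Fin n)) :
    star ((youngCentral lam).coeff h) = (youngCentral lam).coeff h := by
  rw [coeff_youngCentral, star_sum]
  exact Finset.sum_congr rfl fun g _ => star_coeff_youngSymmetrizer lam _

theorem coeff_youngCentral_conj (lam : n.Partition) (g h : Equiv.Perm (Fin n)) :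
    (youngCentral lam).coeff (g * h * g⁻¹) = (youngCentral lam).coeff h := by
  rw [coeff_youngCentral, coeff_youngCentral, ← Equiv.sum_comp (Equiv.mulLeft g)]
  refine Finset.sum_congr rfl fun k _ => ?_
  congr 1
  simp only [Equiv.coe_mulLeft]
  group

theorem coeff_youngCentral_of_isConj (lam : n.Partition) {g h : Equiv.Perm (Fin n)}
    (hgh : IsConj g h) : (youngCentral lam).coeff g = (youngCentral lam).coeff h := by
  obtain ⟨k, rfl⟩ := isConj_iff.1 hgh
  exact (coeff_youngCentral_conj lam k g).symm

theorem coeff_youngCentral_inv (lam : n.Partition) (g : Equiv.Perm (Fin n)) :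
    (youngCentral lam).coeff g⁻¹ = (youngCentral lam).coeff g :=
  coeff_youngCentral_of_isConj lam
    (Equiv.Perm.isConj_iff_cycleType_eq.2 (Equiv.Perm.cycleType_inv g))

theorem mul_comm_of_coeff_conj {z : SymAlgebra n}
    (hz : ∀ g h : Equiv.Perm (Fin n), z.coeff (g * h * g⁻¹) = z.coeff h) (x : SymAlgebra n) :
    z * x = x * z := by
  induction x using MonoidAlgebra.induction_linear with
  | zero => simp
  | add f g hf hg => rw [mul_add, add_mul, hf, hg]
  | single g r =>
    ext h
    rw [MonoidAlgebra.coeff_single_mul_apply, MonoidAlgebra.coeff_mul_single_apply,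
      ← hz g (g⁻¹ * h), mul_comm]
    congr 2
    group

theorem youngCentral_mul_comm (lam : n.Partition) (x : SymAlgebra n) :
    youngCentral lam * x = x * youngCentral lam :=
  mul_comm_of_coeff_conj (coeff_youngCentral_conj lam) x

/-- A central element acts on a Young symmetrizer as a scalar. -/
theorem exists_central_mul_youngSymmetrizer (lam : n.Partition) {z : SymAlgebra n}
    (hz : ∀ x, z * x = x * z) :
    z * youngSymmetrizer lam = (z * youngSymmetrizer lam).coeff 1 • youngSymmetrizer lam := by
  have key : ∃ t : ℂ, z * youngSymmetrizer lam = t • youngSymmetrizer lam := by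
    obtain ⟨α, hα, hd⟩ := exists_youngSymmetrizer_mul_self lam
    obtain ⟨t, ht⟩ := exists_youngSymmetrizer_mul_mul lam z
    have h0 : α ≠ 0 := by
      rintro rfl
      rw [zero_mul] at hd
      exact Nat.factorial_ne_zero n (by exact_mod_cast hd.symm)
    -- Centrality gives `z c = α⁻¹ z c² = α⁻¹ c z c`, where `c` is the Young symmetrizer.
    refine ⟨α⁻¹ * t, ?_⟩
    rw [mul_smul, ← ht, ← hz, mul_assoc, hα, mul_smul_comm, smul_smul, inv_mul_cancel₀ h0,
      one_smul]
  obtain ⟨t, ht⟩ := key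
  rw [ht, MonoidAlgebra.coeff_smul_apply, coeff_one_youngSymmetrizer, smul_eq_mul, mul_one]

theorem central_mul_youngCentral (lam : n.Partition) {z : SymAlgebra n}
    (hz : ∀ x, z * x = x * z) :
    z * youngCentral lam = (z * youngSymmetrizer lam).coeff 1 • youngCentral lam := by
  rw [youngCentral, Finset.mul_sum, Finset.smul_sum]
  refine Finset.sum_congr rfl fun g _ => ?_
  rw [← mul_assoc, ← mul_assoc, hz, mul_assoc (MonoidAlgebra.single g (1 : ℂ)) z,
    exists_central_mul_youngSymmetrizer lam hz, mul_smul_comm, smul_mul_assoc,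
    MonoidAlgebra.coeff_smul_apply, coeff_one_youngSymmetrizer, smul_eq_mul, mul_one]

/-- The scalar by which `youngCentral lam` acts on the Specht module. -/
def youngScalar (lam : n.Partition) : ℂ := (youngCentral lam * youngSymmetrizer lam).coeff 1

theorem youngCentral_mul_youngSymmetrizer (lam : n.Partition) :
    youngCentral lam * youngSymmetrizer lam = youngScalar lam • youngSymmetrizer lam :=
  exists_central_mul_youngSymmetrizer lam (youngCentral_mul_comm lam)

theorem youngCentral_mul_self (lam : n.Partition) :
    youngCentral lam * youngCentral lam = youngScalar lam • youngCentral lam :=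
  central_mul_youngCentral lam (youngCentral_mul_comm lam)

theorem youngCentral_mul_of_ne {lam mu : n.Partition} (h : lam ≠ mu) :
    youngCentral lam * youngCentral mu = 0 := by
  rw [youngCentral, Finset.sum_mul]
  refine Finset.sum_eq_zero fun g _ => ?_
  rw [youngCentral, Finset.mul_sum]
  refine Finset.sum_eq_zero fun k _ => ?_
  have := youngSymmetrizer_mul_mul_youngSymmetrizer_of_ne h
    (MonoidAlgebra.single g⁻¹ (1 : ℂ) * MonoidAlgebra.single k (1 : ℂ))
  calc _ = MonoidAlgebra.single g (1 : ℂ) * (youngSymmetrizer lam *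
        (MonoidAlgebra.single g⁻¹ (1 : ℂ) * MonoidAlgebra.single k (1 : ℂ)) *
        youngSymmetrizer mu) * MonoidAlgebra.single k⁻¹ (1 : ℂ) := by simp only [mul_assoc]
    _ = 0 := by rw [this, mul_zero, zero_mul]

/-- Otherwise `youngCentral lam` squares to zero. Its coefficients are real and invariant under
inversion, so the identity coefficient of the square is the sum of their squared moduli, which
includes `(n!)²`. -/
theorem youngScalar_ne_zero (lam : n.Partition) : youngScalar lam ≠ 0 := by
  intro h0
  have h := youngCentral_mul_self lam
  rw [h0, zero_smul] at h
  have h1 := congrArg (fun x : SymAlgebra n => (x.coeff 1).re) h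
  simp only [coeff_mul_eq_sum, mul_one, coeff_youngCentral_inv, MonoidAlgebra.coeff_zero,
    Finsupp.coe_zero, Pi.zero_apply, Complex.zero_re, Complex.re_sum] at h1
  have h2 : ∀ g, ((youngCentral lam).coeff g * (youngCentral lam).coeff g).re =
      Complex.normSq ((youngCentral lam).coeff g) := by
    intro g
    have hconj : (starRingEnd ℂ) ((youngCentral lam).coeff g) = (youngCentral lam).coeff g :=
      star_coeff_youngCentral lam g
    conv_lhs => rw [← hconj]
    rw [← Complex.normSq_conj, ← Complex.ofReal_re (Complex.normSq _),
      Complex.normSq_eq_conj_mul_self, Complex.conj_conj, hconj]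
  rw [Finset.sum_congr rfl fun g _ => h2 g,
    Finset.sum_eq_zero_iff_of_nonneg fun g _ => Complex.normSq_nonneg _] at h1
  have h3 := h1 1 (Finset.mem_univ _)
  rw [coeff_one_youngCentral, Complex.normSq_eq_zero] at h3
  exact Nat.factorial_ne_zero n (by exact_mod_cast h3)

/-- The linear combination of group elements with coefficients depending on the cycle type. -/
def ofPartitionFun (n : ℕ) :
    ((Fintype.card (Fin n)).Partition → ℂ) →ₗ[ℂ] SymAlgebra n where
  toFun F := ∑ g : Equiv.Perm (Fin n), F g.partition • MonoidAlgebra.single g (1 : ℂ)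
  map_add' F G := by simp only [Pi.add_apply, add_smul, Finset.sum_add_distrib]
  map_smul' t F := by simp only [Pi.smul_apply, smul_eq_mul, mul_smul, Finset.smul_sum,
    RingHom.id_apply]

theorem mem_range_ofPartitionFun {x : SymAlgebra n}
    (hx : ∀ g h : Equiv.Perm (Fin n), IsConj g h → x.coeff g = x.coeff h) :
    x ∈ LinearMap.range (ofPartitionFun n) := by
  have hf : Function.FactorsThrough (fun g => x.coeff g)
      (fun g : Equiv.Perm (Fin n) => g.partition) := fun g h hgh =>
    hx g h (Equiv.Perm.partition_eq_of_isConj.2 hgh)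
  -- The default `0` is never read: only cycle types of actual permutations are evaluated.
  refine ⟨Function.extend (fun g : Equiv.Perm (Fin n) => g.partition) (fun g => x.coeff g) 0, ?_⟩
  conv_rhs => rw [eq_sum_coeff_smul x]
  refine Finset.sum_congr rfl fun g _ => ?_
  rw [hf.extend_apply]

/-- The elements `youngCentral lam` are orthogonal with nonzero squares, hence independent. They lie
in the space of class functions, whose dimension is at most the number of partitions, so they span
it. -/
theorem exists_one_eq_sum_youngCentral (n : ℕ) :
    ∃ w : n.Partition → ℂ, (1 : SymAlgebra n) = ∑ lam, w lam • youngCentral lam := by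
  set v : n.Partition → LinearMap.range (ofPartitionFun n) := fun lam =>
    ⟨youngCentral lam, mem_range_ofPartitionFun fun g h => coeff_youngCentral_of_isConj lam⟩
  have hli : LinearIndependent ℂ v := by
    rw [Fintype.linearIndependent_iff]
    intro w hw mu
    have h1 := congrArg (fun y : LinearMap.range (ofPartitionFun n) =>
      youngCentral mu * (y : SymAlgebra n)) hw
    simp only [Submodule.coe_sum, Submodule.coe_smul, Finset.mul_sum, v, mul_smul_comm,
      Submodule.coe_zero, mul_zero] at h1
    rw [Finset.sum_eq_single mu
      (fun lam _ hne => by rw [youngCentral_mul_of_ne hne.symm, smul_zero])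
      (fun h => absurd (Finset.mem_univ _) h), youngCentral_mul_self] at h1
    have h2 := congrArg (fun y : SymAlgebra n => y.coeff 1) h1
    simp only [MonoidAlgebra.coeff_smul_apply, coeff_one_youngCentral, smul_eq_mul,
      MonoidAlgebra.coeff_zero, Finsupp.coe_zero, Pi.zero_apply, mul_eq_zero, Nat.cast_eq_zero,
      Nat.factorial_ne_zero, or_false, youngScalar_ne_zero] at h2
    exact h2
  have hcard : Fintype.card n.Partition =
      Module.finrank ℂ (LinearMap.range (ofPartitionFun n)) := by
    refine le_antisymm hli.fintype_card_le_finrank ?_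
    refine (LinearMap.finrank_range_le _).trans ?_
    rw [Module.finrank_fintype_fun_eq_card, Fintype.card_fin]
  have h1 : (1 : SymAlgebra n) ∈ LinearMap.range (ofPartitionFun n) := by
    refine mem_range_ofPartitionFun fun g h hgh => ?_
    obtain ⟨k, rfl⟩ := isConj_iff.1 hgh
    simp [MonoidAlgebra.one_def, Finsupp.single_apply, eq_comm]
  have h2 : (⟨1, h1⟩ : LinearMap.range (ofPartitionFun n)) ∈ Submodule.span ℂ (Set.range v) := by
    rw [hli.span_eq_top_of_card_eq_finrank' hcard]
    trivial
  obtain ⟨w, hw⟩ := (Submodule.mem_span_range_iff_exists_fun ℂ).1 h2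
  refine ⟨w, ?_⟩
  have h3 := congrArg (fun y : LinearMap.range (ofPartitionFun n) => (y : SymAlgebra n)) hw
  simp only [Submodule.coe_sum, Submodule.coe_smul, v] at h3
  exact h3.symm

/-- The central idempotent attached to `λ`. -/
def youngIdempotent (lam : n.Partition) : SymAlgebra n :=
  (youngScalar lam)⁻¹ • youngCentral lam

theorem sum_youngIdempotent (n : ℕ) :
    ∑ lam : n.Partition, youngIdempotent lam = (1 : SymAlgebra n) := by
  obtain ⟨w, hw⟩ := exists_one_eq_sum_youngCentral n
  rw [hw]
  refine Finset.sum_congr rfl fun mu _ => ?_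
  -- Multiplying by `youngCentral mu` isolates the coefficient `w mu`, which must be the inverse of
  -- `youngScalar mu`.
  have h1 := congrArg (fun y => youngCentral mu * y) hw
  simp only [mul_one, Finset.mul_sum, mul_smul_comm] at h1
  rw [Finset.sum_eq_single mu
      (fun lam _ hne => by rw [youngCentral_mul_of_ne hne.symm, smul_zero])
      (fun h => absurd (Finset.mem_univ _) h), youngCentral_mul_self, smul_smul] at h1
  have h2 := congrArg (fun y : SymAlgebra n => y.coeff 1) h1
  simp only [MonoidAlgebra.coeff_smul_apply, coeff_one_youngCentral, smul_eq_mul] at h2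
  have h3 : (n ! : ℂ) ≠ 0 := by exact_mod_cast Nat.factorial_ne_zero n
  have h4 : w mu * youngScalar mu = 1 := by
    field_simp at h2
    exact h2.symm
  rw [youngIdempotent, eq_inv_of_mul_eq_one_left h4]

theorem youngIdempotent_mul_comm (lam : n.Partition) (x : SymAlgebra n) :
    youngIdempotent lam * x = x * youngIdempotent lam := by
  rw [youngIdempotent, smul_mul_assoc, youngCentral_mul_comm, mul_smul_comm]

theorem youngIdempotent_mul_youngSymmetrizer (lam : n.Partition) :
    youngIdempotent lam * youngSymmetrizer lam = youngSymmetrizer lam := by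
  rw [youngIdempotent, smul_mul_assoc, youngCentral_mul_youngSymmetrizer, smul_smul,
    inv_mul_cancel₀ (youngScalar_ne_zero lam), one_smul]

theorem youngIdempotent_mul_self (lam : n.Partition) :
    youngIdempotent lam * youngIdempotent lam = youngIdempotent lam := by
  rw [youngIdempotent, smul_mul_assoc, mul_smul_comm, youngCentral_mul_self,
    inv_smul_smul₀ (youngScalar_ne_zero lam)]

theorem central_mul_youngIdempotent (lam : n.Partition) {z : SymAlgebra n}
    (hz : ∀ x, z * x = x * z) :
    z * youngIdempotent lam = (z * youngSymmetrizer lam).coeff 1 • youngIdempotent lam := by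
  rw [youngIdempotent, mul_smul_comm, central_mul_youngCentral lam hz, smul_comm]

theorem star_youngScalar (lam : n.Partition) : star (youngScalar lam) = youngScalar lam := by
  rw [youngScalar, coeff_mul_eq_sum, star_sum]
  refine Finset.sum_congr rfl fun g _ => ?_
  rw [star_mul', star_coeff_youngCentral, star_coeff_youngSymmetrizer]

theorem star_coeff_youngIdempotent (lam : n.Partition) (g : Equiv.Perm (Fin n)) :
    star ((youngIdempotent lam).coeff g) = (youngIdempotent lam).coeff g⁻¹ := by
  rw [youngIdempotent, MonoidAlgebra.coeff_smul_apply, MonoidAlgebra.coeff_smul_apply,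
    coeff_youngCentral_inv, smul_eq_mul, star_mul', star_coeff_youngCentral, star_inv₀,
    star_youngScalar]

/-! ### Irreducibility of the Specht modules -/

theorem youngIdempotent_mul_of_mem (lam : n.Partition) {x : SymAlgebra n}
    (hx : x ∈ spechtModule lam) : youngIdempotent lam * x = x := by
  obtain ⟨a, rfl⟩ := Submodule.mem_span_singleton.1 hx
  rw [smul_eq_mul, ← mul_assoc, youngIdempotent_mul_comm, mul_assoc,
    youngIdempotent_mul_youngSymmetrizer]

theorem isSimpleModule_spechtModule (lam : n.Partition) :
    IsSimpleModule (SymAlgebra n) (spechtModule lam) := by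
  rw [isSimpleModule_iff_isAtom]
  have hc : youngSymmetrizer lam ∈ spechtModule lam := Submodule.mem_span_singleton_self _
  constructor
  · intro h
    rw [h, Submodule.mem_bot] at hc
    have := coeff_one_youngSymmetrizer lam
    rw [hc] at this
    simp at this
  · intro N hN
    by_contra hne
    obtain ⟨x, hx, hx0⟩ := N.exists_mem_ne_zero_of_ne_bot hne
    refine hN.not_ge ?_
    -- With `y = a c`, the product `c y = c a c` is a nonzero multiple of the generator `c`, which
    -- therefore lies in `N`.
    suffices h : ∃ y ∈ N, youngSymmetrizer lam * y ≠ 0 by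
      obtain ⟨y, hy, hy0⟩ := h
      obtain ⟨a, ha⟩ := Submodule.mem_span_singleton.1 (hN.le hy)
      obtain ⟨t, ht⟩ := exists_youngSymmetrizer_mul_mul lam a
      have h1 : youngSymmetrizer lam * y = t • youngSymmetrizer lam := by
        rw [← ha, smul_eq_mul, ← mul_assoc, ht]
      have ht0 : t ≠ 0 := by
        rintro rfl
        exact hy0 (by rw [h1, zero_smul])
      have h2 : (t⁻¹ • youngSymmetrizer lam) • y ∈ N := N.smul_mem _ hy
      rw [smul_eq_mul, smul_mul_assoc, h1, inv_smul_smul₀ ht0] at h2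
      exact (Submodule.span_singleton_le_iff_mem _ _).2 h2
    -- If `c_λ` annihilates `N`, so do its conjugates and hence the central idempotent, which
    -- nevertheless fixes every element of the Specht module.
    by_contra! hall
    apply hx0
    rw [← youngIdempotent_mul_of_mem lam (hN.le hx), youngIdempotent, youngCentral,
      smul_mul_assoc, Finset.sum_mul, Finset.sum_eq_zero, smul_zero]
    intro g _
    rw [mul_assoc, mul_assoc,
      hall (MonoidAlgebra.single g⁻¹ (1 : ℂ) * x)
        (N.smul_mem (MonoidAlgebra.single g⁻¹ (1 : ℂ)) hx),
      mul_zero]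

end Central

/-! ### Permutation matrices -/

section PermMatrix

variable {ι κ : Type*} [DecidableEq ι] {n : ℕ}

theorem permUnitary_one : permUnitary ι (1 : Equiv.Perm (Fin n)) = 1 := by
  ext i j
  simp [permUnitary, Matrix.one_apply]

theorem conjTranspose_permUnitary (σ : Equiv.Perm (Fin n)) :
    (permUnitary ι σ)ᴴ = permUnitary ι σ⁻¹ := by
  ext i j
  simp only [permUnitary, Matrix.conjTranspose_apply, Matrix.of_apply, inv_inv]
  have : j = i ∘ ⇑σ⁻¹ ↔ i = j ∘ ⇑σ := by
    constructor
    · rintro rfl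
      ext x
      simp
    · rintro rfl
      ext x
      simp
  simp only [this]
  split_ifs <;> simp

variable [Fintype ι]

theorem mul_permUnitary_apply (σ : Equiv.Perm (Fin n)) (N : Matrix κ (Fin n → ι) ℂ)
    (i : κ) (j : Fin n → ι) : (N * permUnitary ι σ) i j = N i (j ∘ ⇑σ⁻¹) := by
  simp [Matrix.mul_apply, permUnitary]

theorem permUnitary_mul_apply (σ : Equiv.Perm (Fin n)) (N : Matrix (Fin n → ι) κ ℂ)
    (i : Fin n → ι) (j : κ) : (permUnitary ι σ * N) i j = N (i ∘ ⇑σ) j := by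
  have : ∀ k, i = k ∘ ⇑σ⁻¹ ↔ i ∘ ⇑σ = k := by
    intro k
    constructor
    · rintro rfl
      ext x
      simp
    · rintro rfl
      ext x
      simp
  simp only [Matrix.mul_apply, permUnitary, Matrix.of_apply, this]
  simp

theorem permUnitary_mul (σ τ : Equiv.Perm (Fin n)) :
    permUnitary ι (σ * τ) = permUnitary ι σ * permUnitary ι τ := by
  ext i j
  rw [mul_permUnitary_apply]
  simp [permUnitary, Function.comp_assoc]

/-- The action of the group algebra of `Sₙ` on `(ℂ^r)^{⊗n}` in matrix form. -/
def permMatrix (n r : ℕ) :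
    SymAlgebra n →ₐ[ℂ] Matrix (Fin n → Fin r) (Fin n → Fin r) ℂ :=
  MonoidAlgebra.lift ℂ _ (Equiv.Perm (Fin n))
    { toFun := permUnitary (Fin r)
      map_one' := permUnitary_one
      map_mul' := permUnitary_mul }

theorem permMatrix_single (r : ℕ) (σ : Equiv.Perm (Fin n)) (t : ℂ) :
    permMatrix n r (MonoidAlgebra.single σ t) = t • permUnitary (Fin r) σ := by
  simp [permMatrix]

theorem permMatrix_eq_sum (r : ℕ) (x : SymAlgebra n) :
    permMatrix n r x = ∑ σ, x.coeff σ • permUnitary (Fin r) σ := by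
  conv_lhs => rw [eq_sum_coeff_smul x]
  simp [permMatrix_single, -MonoidAlgebra.smul_single]

theorem asAlgebraHom_permRep (r : ℕ) (x : SymAlgebra n) :
    (permRep n r).asAlgebraHom x = Matrix.toEuclideanLin (permMatrix n r x) := by
  rw [permMatrix_eq_sum, map_sum]
  conv_lhs => rw [eq_sum_coeff_smul x]
  simp only [map_sum, map_smul, Representation.asAlgebraHom_single_one]
  rfl

theorem trace_asAlgebraHom_permRep (r : ℕ) (x : SymAlgebra n) :
    LinearMap.trace ℂ _ ((permRep n r).asAlgebraHom x) = (permMatrix n r x).trace := by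
  rw [asAlgebraHom_permRep, Matrix.toEuclideanLin_eq_toLin_orthonormal,
    Matrix.trace_toLin_eq]

/-! ### The isotypic projectors -/

theorem isHermitian_permMatrix_youngIdempotent (r : ℕ) (lam : n.Partition) :
    (permMatrix n r (youngIdempotent lam)).IsHermitian := by
  rw [Matrix.IsHermitian, permMatrix_eq_sum, Matrix.conjTranspose_sum,
    ← Equiv.sum_comp (Equiv.inv (Equiv.Perm (Fin n)))]
  refine Finset.sum_congr rfl fun σ _ => ?_
  rw [Matrix.conjTranspose_smul, conjTranspose_permUnitary, star_coeff_youngIdempotent]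
  simp

/-- The idempotent fixes every copy of `[λ]`, and its fixed points form a submodule because it is
central. Conversely, its values are combinations of vectors `g c_λ m`, and `c_λ m` is the image of
`c_λ` under the homomorphism `a ↦ a m` from the simple module `[λ]`. -/
theorem isotypicSubspace_eq_range (r : ℕ) (lam : n.Partition) :
    isotypicSubspace r lam =
      LinearMap.range ((permRep n r).asAlgebraHom (youngIdempotent lam)) := by
  have := isSimpleModule_spechtModule lam
  apply le_antisymm
  · rw [isotypicSubspace, Submodule.map_le_iff_le_comap]
    let K : Submodule (SymAlgebra n) (permRep n r).asModule :=
      { carrier := {x | youngIdempotent lam • x = x}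
        add_mem' := fun {x y} hx hy => by
          change youngIdempotent lam • (x + y) = x + y
          rw [smul_add, show youngIdempotent lam • x = x from hx,
            show youngIdempotent lam • y = y from hy]
        zero_mem' := smul_zero _
        smul_mem' := fun a x hx => by
          change youngIdempotent lam • (a • x) = a • x
          rw [smul_smul, youngIdempotent_mul_comm, ← smul_smul,
            show youngIdempotent lam • x = x from hx] }
    have hK : isotypicComponent (SymAlgebra n) (permRep n r).asModule (spechtModule lam) ≤ K := by
      refine sSup_le ?_
      rintro m ⟨f⟩ x hx
      change youngIdempotent lam • x = x
      have h1 : youngIdempotent lam • (⟨x, hx⟩ : m) = ⟨x, hx⟩ := by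
        apply f.injective
        rw [map_smul]
        exact Subtype.ext (youngIdempotent_mul_of_mem lam (f ⟨x, hx⟩).2)
      exact congrArg Subtype.val h1
    intro x hx
    exact ⟨(permRep n r).asModuleEquiv x, hK hx⟩
  · rintro _ ⟨x, rfl⟩
    refine ⟨youngIdempotent lam • (permRep n r).asModuleEquiv.symm x, ?_, rfl⟩
    set N := isotypicComponent (SymAlgebra n) (permRep n r).asModule (spechtModule lam)
    change _ ∈ N
    generalize (permRep n r).asModuleEquiv.symm x = m
    rw [youngIdempotent, smul_assoc]
    refine N.smul_of_tower_mem _ ?_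
    rw [youngCentral, Finset.sum_smul]
    refine N.sum_mem fun g _ => ?_
    rw [mul_assoc, mul_smul, mul_smul]
    refine N.smul_mem _ ?_
    refine (spechtModule lam).map_le_isotypicComponent (LinearMap.toSpanSingleton (SymAlgebra n) _
      (MonoidAlgebra.single g⁻¹ (1 : ℂ) • m)) ?_
    exact ⟨youngSymmetrizer lam, Submodule.mem_span_singleton_self _, rfl⟩

/-- A symmetric idempotent is the orthogonal projector onto its range. -/
theorem isotypicProjector_eq (r : ℕ) (lam : n.Partition) :
    isotypicProjector r lam = permMatrix n r (youngIdempotent lam) := by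
  rw [isotypicProjector, LinearEquiv.symm_apply_eq, ← asAlgebraHom_permRep]
  set E := (permRep n r).asAlgebraHom (youngIdempotent lam) with hE
  have hsymm : E.IsSymmetric := by
    rw [hE, asAlgebraHom_permRep]
    exact Matrix.isSymmetric_toEuclideanLin_iff.2 (isHermitian_permMatrix_youngIdempotent r lam)
  have hidem : ∀ x, E (E x) = E x := by
    intro x
    rw [← Module.End.mul_apply, hE, ← map_mul, youngIdempotent_mul_self]
  ext1 x
  change (isotypicSubspace r lam).starProjection x = E x
  refine Submodule.eq_starProjection_of_mem_of_inner_eq_zero ?_ ?_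
  · rw [isotypicSubspace_eq_range]
    exact ⟨x, rfl⟩
  · intro w hw
    rw [isotypicSubspace_eq_range] at hw
    obtain ⟨y, rfl⟩ := hw
    rw [← hE, ← hsymm, map_sub, hidem, sub_self, inner_zero_left]

/-! ### Inverting the Gram operator -/

/-- The first column has more than `r` entries, so a basis index takes the same value at two of
them. Swapping these fixes the basis vector but reverses the sign of the antisymmetrizer. -/
theorem permMatrix_youngSymmetrizer_eq_zero {r : ℕ} {lam : n.Partition}
    (h : r < lam.parts.card) : permMatrix n r (youngSymmetrizer lam) = 0 := by
  rw [youngSymmetrizer, map_mul]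
  suffices hb : permMatrix n r (colAntisymmetrizer lam) = 0 by rw [hb, mul_zero]
  ext i j
  obtain ⟨x, hx, y, hy, hxy, hj⟩ := Finset.exists_ne_map_eq_of_card_lt_of_maps_to
    (s := Finset.univ.filter fun x => colIdx lam x = 0) (t := (Finset.univ : Finset (Fin r)))
    (f := j) (by rwa [card_colIdx_eq, colLen_zero_diagram, Finset.card_univ, Fintype.card_fin])
    (fun x _ => Finset.mem_coe.2 (Finset.mem_univ _))
  simp only [Finset.mem_filter, Finset.mem_univ, true_and] at hx hy
  have h1 := colAntisymmetrizer_mul_single lam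
    (apply_swap_eq (colIdx lam) (hx.trans hy.symm))
  have h2 := congrArg (fun z => permMatrix n r z i j) h1
  have h3 : j ∘ ⇑(Equiv.swap x y) = j := funext (apply_swap_eq j hj)
  simp only [map_mul, permMatrix_single, one_smul, mul_permUnitary_apply, Equiv.swap_inv, h3,
    Equiv.Perm.sign_swap hxy, map_smul] at h2
  simpa [self_eq_neg] using h2

/-- The central element `∑ σ, Tr(U_σ⁻¹) σ`. -/
def gramElement (n r : ℕ) : SymAlgebra n :=
  ∑ σ : Equiv.Perm (Fin n), (permUnitary (Fin r) σ⁻¹).trace • MonoidAlgebra.single σ (1 : ℂ)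

theorem coeff_gramElement (r : ℕ) (σ : Equiv.Perm (Fin n)) :
    (gramElement n r).coeff σ = (permUnitary (Fin r) σ⁻¹).trace := by
  simp [gramElement, MonoidAlgebra.coeff_sum, Finsupp.single_apply]

theorem gramElement_mul_comm (r : ℕ) (x : SymAlgebra n) :
    gramElement n r * x = x * gramElement n r := by
  refine mul_comm_of_coeff_conj (fun g h => ?_) x
  rw [coeff_gramElement, coeff_gramElement, mul_inv_rev, mul_inv_rev, inv_inv, permUnitary_mul,
    Matrix.trace_mul_comm, ← permUnitary_mul]
  simp

/-- This turns the scalar by which the Gram element acts on `[λ]` into the trace of `c_λ` on tensor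
space. -/
theorem coeff_one_gramElement_mul (r : ℕ) (x : SymAlgebra n) :
    (gramElement n r * x).coeff 1 = (permMatrix n r x).trace := by
  rw [coeff_mul_eq_sum, permMatrix_eq_sum, Matrix.trace_sum,
    ← Equiv.sum_comp (Equiv.inv (Equiv.Perm (Fin n)))]
  refine Finset.sum_congr rfl fun σ _ => ?_
  simp [coeff_gramElement, mul_comm]

theorem permMatrix_youngIdempotent_eq_zero {r : ℕ} {lam : n.Partition}
    (h : permMatrix n r (youngSymmetrizer lam) = 0) :
    permMatrix n r (youngIdempotent lam) = 0 := by
  rw [youngIdempotent, youngCentral, map_smul, map_sum, Finset.sum_eq_zero, smul_zero]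
  intro g _
  rw [map_mul, map_mul, h, mul_zero, zero_mul]

theorem permMatrix_gramElement_mul_isotypicProjector (r : ℕ) (lam : n.Partition) :
    ((1 / (n ! : ℂ)) * ((dimSpecht lam : ℂ) / (dimWeyl r lam : ℂ))) •
      (permMatrix n r (gramElement n r) * isotypicProjector r lam) =
        isotypicProjector r lam := by
  obtain ⟨α, hα, hd⟩ := exists_youngSymmetrizer_mul_self lam
  have htr := trace_eq_mul_finrank_range
    ((permRep n r).asAlgebraHom (youngSymmetrizer lam)) α (by rw [← map_mul, hα, map_smul])
  rw [trace_asAlgebraHom_permRep, ← coeff_one_gramElement_mul] at htr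
  change _ = α * (dimWeyl r lam : ℂ) at htr
  rw [isotypicProjector_eq, ← map_mul, central_mul_youngIdempotent lam (gramElement_mul_comm r),
    htr, map_smul, smul_smul]
  -- Here the quotient in the coefficient is a division by zero, but the projector itself vanishes.
  by_cases hm : dimWeyl r lam = 0
  · have h0 : (permRep n r).asAlgebraHom (youngSymmetrizer lam) = 0 := by
      rw [← LinearMap.range_eq_bot]
      exact Submodule.finrank_eq_zero.1 hm
    rw [asAlgebraHom_permRep, LinearEquiv.map_eq_zero_iff] at h0
    rw [permMatrix_youngIdempotent_eq_zero h0, smul_zero]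
  · have hm' : (dimWeyl r lam : ℂ) ≠ 0 := by exact_mod_cast hm
    have hn : (n ! : ℂ) ≠ 0 := by exact_mod_cast Nat.factorial_ne_zero n
    convert one_smul ℂ _ using 2
    rw [← hd] at hn ⊢
    have h1 := left_ne_zero_of_mul hn
    have h2 := right_ne_zero_of_mul hn
    field_simp

theorem sum_isotypicProjector (n r : ℕ) :
    ∑ lam : n.Partition with lam.parts.card ≤ r, isotypicProjector r lam = 1 := by
  rw [← map_one (permMatrix n r), ← sum_youngIdempotent, map_sum, Finset.sum_filter]
  refine Finset.sum_congr rfl fun lam _ => ?_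
  split_ifs with h
  · exact isotypicProjector_eq r lam
  · rw [permMatrix_youngIdempotent_eq_zero
      (permMatrix_youngSymmetrizer_eq_zero (not_le.1 h))]

/-- The operator `∑ σ, Tr(U_σ†) U_σ` is inverted by
`∑ λ, (1 / n!) (dim [λ] / dim 𝒰_{r,λ}) Π_λ`. -/
theorem gram_mul_weingarten (n r : ℕ) :
    (∑ σ : Equiv.Perm (Fin n), (permUnitary (Fin r) σ)ᴴ.trace • permUnitary (Fin r) σ) *
      ∑ lam : n.Partition with lam.parts.card ≤ r,
        ((1 / (n ! : ℂ)) * ((dimSpecht lam : ℂ) / (dimWeyl r lam : ℂ))) •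
          isotypicProjector r lam = 1 := by
  have h : (∑ σ : Equiv.Perm (Fin n), (permUnitary (Fin r) σ)ᴴ.trace • permUnitary (Fin r) σ) =
      permMatrix n r (gramElement n r) := by
    rw [permMatrix_eq_sum]
    simp only [coeff_gramElement, conjTranspose_permUnitary]
  rw [h, Finset.mul_sum, ← sum_isotypicProjector n r]
  refine Finset.sum_congr rfl fun lam _ => ?_
  rw [mul_smul_comm, permMatrix_gramElement_mul_isotypicProjector]

end PermMatrix

/-! ### Tensor powers of matrices -/

section TensorPow

variable {ι κ μ : Type*} {n : ℕ}

theorem tensorPow_mul [Fintype κ] (M : Matrix ι κ ℂ) (N : Matrix κ μ ℂ) :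
    tensorPow n (M * N) = tensorPow n M * tensorPow n N := by
  ext i j
  simp only [tensorPow, Matrix.of_apply, Matrix.mul_apply, Finset.prod_univ_sum,
    Fintype.piFinset_univ, Finset.prod_mul_distrib]

theorem tensorPow_diagonal [DecidableEq ι] (d : ι → ℂ) :
    tensorPow n (Matrix.diagonal d) = Matrix.diagonal fun i : Fin n → ι => ∏ k, d (i k) := by
  ext i j
  simp only [tensorPow, Matrix.of_apply, Matrix.diagonal_apply, Finset.prod_ite_zero,
    Finset.mem_univ, true_implies, funext_iff]

theorem tensorPow_one [DecidableEq ι] : tensorPow n (1 : Matrix ι ι ℂ) = 1 := by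
  rw [← Matrix.diagonal_one, tensorPow_diagonal]
  simp

theorem permUnitary_mul_tensorPow [Fintype ι] [DecidableEq ι] [Fintype κ] [DecidableEq κ]
    (σ : Equiv.Perm (Fin n)) (M : Matrix ι κ ℂ) :
    permUnitary ι σ * tensorPow n M = tensorPow n M * permUnitary κ σ := by
  ext i j
  rw [permUnitary_mul_apply, mul_permUnitary_apply]
  simp only [tensorPow, Matrix.of_apply, Function.comp_apply]
  rw [← Equiv.prod_comp σ fun k => M (i k) (j (σ⁻¹ k))]
  simp

/-- Expand `∏ l, (-1 + [l ∉ R])`, with `S` the set of factors contributing `-1`. -/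
theorem sum_powerset_neg_one_pow_mul_indicator (R : Finset (Fin n)) :
    ∑ S : Finset (Fin n), (-1 : ℂ) ^ S.card * (if R ⊆ S then 1 else 0) =
      if R = Finset.univ then (-1) ^ n else 0 := by
  have h := Finset.prod_add (fun _ : Fin n => (-1 : ℂ)) (fun l => if l ∈ R then 0 else 1)
    Finset.univ
  have h1 : ∀ l, (-1 : ℂ) + (if l ∈ R then 0 else 1) = if l ∈ R then -1 else 0 := by
    intro l
    split_ifs <;> simp
  simp only [h1, Finset.prod_ite_zero, Finset.prod_const, Finset.powerset_univ, Finset.card_univ,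
    Fintype.card_fin] at h
  simp only [← Finset.univ_subset_iff, Finset.subset_iff]
  rw [h]
  refine Finset.sum_congr rfl fun S _ => ?_
  congr 1
  have h2 : ∀ l, (if l ∈ R then (0 : ℂ) else 1) = if l ∉ R then 1 else 0 := by
    intro l
    split_ifs <;> simp_all
  simp only [h2, Finset.prod_ite_zero, Finset.prod_const_one, Finset.mem_sdiff, Finset.mem_univ,
    true_and]
  congr 1
  refine propext (forall_congr' fun l => ?_)
  tauto

/-- Ryser's formula for the permanent. -/
theorem sum_powerset_neg_one_pow_mul_prod_sum (M : Fin n → Fin n → ℂ) :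
    ∑ S : Finset (Fin n), (-1 : ℂ) ^ S.card * ∏ k, ∑ l ∈ S, M l k =
      (-1) ^ n * ∑ σ : Equiv.Perm (Fin n), ∏ k, M (σ k) k := by
  -- Sorting the expansion by the image of `f` lets the alternating sum over `S` eliminate all
  -- non-surjective `f`.
  have h1 : ∀ S : Finset (Fin n), ∏ k, ∑ l ∈ S, M l k =
      ∑ f : Fin n → Fin n, (if Finset.univ.image f ⊆ S then 1 else 0) * ∏ k, M (f k) k := by
    intro S
    rw [Finset.prod_univ_sum, ← Finset.sum_subset (Finset.subset_univ (Fintype.piFinset _))]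
    · refine Finset.sum_congr rfl fun f hf => ?_
      rw [if_pos, one_mul]
      intro l hl
      obtain ⟨k, -, rfl⟩ := Finset.mem_image.1 hl
      exact Fintype.mem_piFinset.1 hf k
    · intro f _ hf
      rw [if_neg, zero_mul]
      exact fun h => hf (Fintype.mem_piFinset.2 fun k =>
        h (Finset.mem_image_of_mem f (Finset.mem_univ k)))
  simp only [h1, Finset.mul_sum]
  rw [Finset.sum_comm]
  simp only [← mul_assoc]
  simp only [← Finset.sum_mul, sum_powerset_neg_one_pow_mul_indicator]
  simp only [ite_mul, zero_mul]
  rw [← Finset.sum_filter]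
  symm
  refine Finset.sum_bij (fun σ _ => ⇑σ) ?_ ?_ ?_ ?_
  · intro σ _
    simp [Finset.image_univ_equiv]
  · intro σ _ τ _ h
    exact DFunLike.coe_injective h
  · intro f hf
    have hf' : Function.Surjective f := by
      intro y
      have : y ∈ Finset.univ.image f := by
        rw [(Finset.mem_filter.1 hf).2]
        exact Finset.mem_univ y
      obtain ⟨x, -, hx⟩ := Finset.mem_image.1 this
      exact ⟨x, hx⟩
    exact ⟨Equiv.ofBijective f (Finite.surjective_iff_bijective.1 hf'), Finset.mem_univ _, rfl⟩
  · intro σ _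
    rfl

end TensorPow

/-! ### The commutant of the tensor powers of unitaries -/

section Commutant

variable {n r : ℕ} {Z : Matrix (Fin n → Fin r) (Fin n → Fin r) ℂ}

theorem commute_tensorPow_diagonal
    (hZ : ∀ U ∈ Matrix.unitaryGroup (Fin r) ℂ, Commute Z (tensorPow n U)) (d : Fin r → ℂ) :
    Commute Z (tensorPow n (Matrix.diagonal d)) := by
  rw [tensorPow_diagonal, Commute, SemiconjBy]
  ext i j
  rw [Matrix.mul_diagonal, Matrix.diagonal_mul, mul_comm]
  by_cases hij : Z i j = 0
  · simp [hij]
  congr 1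
  -- A nonzero entry `Z i j` forces `i` and `j` to use each letter equally often. A root of unity of
  -- order `n + 1` in position `a` detects this, since the counts are at most `n`.
  have hcount : ∀ a : Fin r, (Finset.univ.filter fun k => j k = a).card =
      (Finset.univ.filter fun k => i k = a).card := by
    intro a
    obtain ⟨w, hw⟩ : ∃ w : ℂ, IsPrimitiveRoot w (n + 1) :=
      ⟨_, Complex.isPrimitiveRoot_exp (n + 1) n.succ_ne_zero⟩
    have hnorm : ‖w‖ = 1 := hw.norm'_eq_one n.succ_ne_zero
    have hU : Matrix.diagonal (fun b => if b = a then w else 1) ∈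
        Matrix.unitaryGroup (Fin r) ℂ := by
      rw [Matrix.mem_unitaryGroup_iff, Matrix.star_eq_conjTranspose,
        Matrix.diagonal_conjTranspose, Matrix.diagonal_mul_diagonal, ← Matrix.diagonal_one]
      congr 1
      ext b
      by_cases hb : b = a
      · simp [hb, Complex.mul_conj, Complex.normSq_eq_norm_sq, hnorm]
      · simp [hb]
    have h := congrFun (congrFun (hZ _ hU) i) j
    rw [tensorPow_diagonal, Matrix.mul_diagonal, Matrix.diagonal_mul, mul_comm] at h
    have h2 := mul_right_cancel₀ hij h
    simp only [Finset.prod_ite, Finset.prod_const, one_pow, mul_one] at h2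
    refine hw.pow_inj ?_ ?_ h2
    all_goals exact Nat.lt_succ_of_le ((Finset.card_le_univ _).trans (by simp))
  have hprod : ∀ i : Fin n → Fin r,
      ∏ k, d (i k) = ∏ a, d a ^ (Finset.univ.filter fun k => i k = a).card := by
    intro i
    rw [← Finset.prod_fiberwise' Finset.univ i d]
    simp
  rw [hprod, hprod]
  exact Finset.prod_congr rfl fun a _ => by rw [hcount]

theorem commute_tensorPow_of_isHermitian
    (hZ : ∀ U ∈ Matrix.unitaryGroup (Fin r) ℂ, Commute Z (tensorPow n U))
    {H : Matrix (Fin r) (Fin r) ℂ} (hH : H.IsHermitian) : Commute Z (tensorPow n H) := by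
  rw [hH.spectral_theorem, Unitary.conjStarAlgAut_apply, tensorPow_mul, tensorPow_mul]
  exact ((hZ _ hH.eigenvectorUnitary.2).mul_right (commute_tensorPow_diagonal hZ _)).mul_right
    (hZ _ (star hH.eigenvectorUnitary).2)

/-- Write `M = H + i K` with `H`, `K` Hermitian. Each entry of the commutator with `(H + t K)^{⊗n}`
is a polynomial in `t` that vanishes at all real `t`, hence at `t = i`. -/
theorem commute_tensorPow
    (hZ : ∀ U ∈ Matrix.unitaryGroup (Fin r) ℂ, Commute Z (tensorPow n U))
    (M : Matrix (Fin r) (Fin r) ℂ) : Commute Z (tensorPow n M) := by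
  obtain ⟨H, K, hH, hK, rfl⟩ : ∃ H K : Matrix (Fin r) (Fin r) ℂ, H.IsHermitian ∧
      K.IsHermitian ∧ M = H + Complex.I • K :=
    ⟨realPart M, imaginaryPart M, (realPart M).2, (imaginaryPart M).2,
      (realPart_add_I_smul_imaginaryPart M).symm⟩
  rw [Commute, SemiconjBy]
  ext i j
  let q : (Fin n → Fin r) → (Fin n → Fin r) → Polynomial ℂ := fun i j =>
    ∏ k, (Polynomial.C (H (i k) (j k)) + Polynomial.C (K (i k) (j k)) * Polynomial.X)
  let p : Polynomial ℂ := ∑ k, Polynomial.C (Z i k) * q k j - ∑ k, q i k * Polynomial.C (Z k j)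
  have hp : ∀ t : ℂ, p.eval t =
      (Z * tensorPow n (H + t • K)) i j - (tensorPow n (H + t • K) * Z) i j := by
    intro t
    simp [p, q, Polynomial.eval_finsetSum, Polynomial.eval_prod, Matrix.mul_apply, tensorPow,
      mul_comm t]
  have hp0 : p = 0 := by
    refine Polynomial.eq_zero_of_infinite_isRoot p
      (Set.infinite_of_injective_forall_mem Complex.ofReal_injective fun t : ℝ => ?_)
    change p.eval (t : ℂ) = 0
    have hHK : (H + (t : ℂ) • K).IsHermitian := by
      refine hH.add ?_
      rw [Matrix.IsHermitian, Matrix.conjTranspose_smul, hK.eq]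
      simp
    rw [hp, (commute_tensorPow_of_isHermitian hZ hHK).eq, sub_self]
  have h := hp Complex.I
  rw [hp0, Polynomial.eval_zero] at h
  exact sub_eq_zero.1 h.symm

theorem permUnitary_mul_single_mul_apply (σ : Equiv.Perm (Fin n)) (i j a b : Fin n → Fin r) :
    (permUnitary (Fin r) σ * Matrix.single i j (1 : ℂ) * (permUnitary (Fin r) σ)ᴴ) a b =
      ∏ k, Matrix.single (i (σ⁻¹ k)) (j (σ⁻¹ k)) (1 : ℂ) (a k) (b k) := by
  rw [conjTranspose_permUnitary, mul_permUnitary_apply, permUnitary_mul_apply]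
  simp only [Matrix.single_apply, inv_inv, Finset.prod_ite_zero, Finset.prod_const_one]
  congr 1
  rw [funext_iff, funext_iff, ← forall_and]
  refine propext ((Equiv.forall_congr_right σ⁻¹).symm.trans ?_)
  simp

/-- Polarization: by Ryser's formula the symmetrized matrix unit is a combination of tensor powers
of sums of one-site matrix units. -/
theorem commute_sum_conj_single
    (hZ : ∀ U ∈ Matrix.unitaryGroup (Fin r) ℂ, Commute Z (tensorPow n U)) (i j : Fin n → Fin r) :
    Commute Z (∑ σ : Equiv.Perm (Fin n),
      permUnitary (Fin r) σ * Matrix.single i j (1 : ℂ) * (permUnitary (Fin r) σ)ᴴ) := by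
  have h : (∑ σ : Equiv.Perm (Fin n),
      permUnitary (Fin r) σ * Matrix.single i j (1 : ℂ) * (permUnitary (Fin r) σ)ᴴ) =
      (-1 : ℂ) ^ n • ∑ S : Finset (Fin n), (-1 : ℂ) ^ S.card •
        tensorPow n (∑ l ∈ S, Matrix.single (i l) (j l) (1 : ℂ)) := by
    ext a b
    have hr := sum_powerset_neg_one_pow_mul_prod_sum
      (fun l k => Matrix.single (i l) (j l) (1 : ℂ) (a k) (b k))
    simp only [Matrix.sum_apply, Matrix.smul_apply, tensorPow, Matrix.of_apply, smul_eq_mul,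
      permUnitary_mul_single_mul_apply]
    rw [hr, ← mul_assoc, ← mul_pow]
    simp only [mul_neg, mul_one, neg_neg, one_pow, one_mul]
    exact Equiv.sum_comp (Equiv.inv (Equiv.Perm (Fin n))) fun σ : Equiv.Perm (Fin n) =>
      ∏ k, Matrix.single (i (σ k)) (j (σ k)) (1 : ℂ) (a k) (b k)
  rw [h]
  exact (Commute.sum_right _ _ _ fun S _ => (commute_tensorPow hZ _).smul_right _).smul_right _

theorem mul_gram_eq
    (hZ : ∀ U ∈ Matrix.unitaryGroup (Fin r) ℂ, Commute Z (tensorPow n U)) :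
    Z * ∑ σ : Equiv.Perm (Fin n), (permUnitary (Fin r) σ)ᴴ.trace • permUnitary (Fin r) σ =
      ∑ σ : Equiv.Perm (Fin n), ((permUnitary (Fin r) σ)ᴴ * Z).trace • permUnitary (Fin r) σ := by
  have hsingle : ∀ (P Q : Matrix (Fin n → Fin r) (Fin n → Fin r) ℂ) (i j a b : Fin n → Fin r),
      (P * Matrix.single i j (1 : ℂ) * Q) a b = P a i * Q j b := by
    intro P Q i j a b
    simp [Matrix.mul_apply, Matrix.single_apply, ite_and, Finset.sum_ite_eq]
  ext a i
  -- This is the `(a, j)` entry of the commutation relation for `|i⟩⟨j|`; summing over `j` produces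
  -- both traces.
  have h : ∀ j, ∑ σ : Equiv.Perm (Fin n),
      (Z * permUnitary (Fin r) σ) a i * (permUnitary (Fin r) σ)ᴴ j j =
      ∑ σ : Equiv.Perm (Fin n),
        permUnitary (Fin r) σ a i * ((permUnitary (Fin r) σ)ᴴ * Z) j j := by
    intro j
    have h1 := congrFun (congrFun (commute_sum_conj_single hZ i j).eq a) j
    rw [Finset.mul_sum, Finset.sum_mul, Matrix.sum_apply, Matrix.sum_apply] at h1
    simpa only [← mul_assoc, hsingle, mul_assoc _ (permUnitary (Fin r) _)ᴴ Z] using h1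
  have h2 := Finset.sum_congr (rfl : (Finset.univ : Finset (Fin n → Fin r)) = Finset.univ)
    fun j _ => h j
  rw [Finset.sum_comm, Finset.sum_comm (f := fun j σ => permUnitary (Fin r) σ a i * _)] at h2
  simp only [← Finset.mul_sum] at h2
  simp only [Finset.mul_sum, mul_smul_comm, Matrix.sum_apply, Matrix.smul_apply, smul_eq_mul]
  exact (Finset.sum_congr rfl fun σ _ => mul_comm _ _).trans
    (h2.trans (Finset.sum_congr rfl fun σ _ => mul_comm _ _))

end Commutant

/-! ### Twirling over the unitary group -/

section Twirl

variable {n r : ℕ}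

instance instIsProbabilityMeasureUnitaryHaar (r : ℕ) :
    MeasureTheory.IsProbabilityMeasure (unitaryHaar r) :=
  ⟨MeasureTheory.Measure.haarMeasure_self⟩

instance instIsMulLeftInvariantUnitaryHaar (r : ℕ) :
    (unitaryHaar r).IsMulLeftInvariant := by
  unfold unitaryHaar
  infer_instance

/-- The twirl `M ↦ 𝔼_U [U^{⊗n} M (U†)^{⊗n}]`. -/
def twirl (M : Matrix (Fin n → Fin r) (Fin n → Fin r) ℂ) :
    Matrix (Fin n → Fin r) (Fin n → Fin r) ℂ :=
  Matrix.of fun e f => ∫ U : Matrix.unitaryGroup (Fin r) ℂ,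
    (tensorPow n (U : Matrix (Fin r) (Fin r) ℂ) * M *
      tensorPow n (U : Matrix (Fin r) (Fin r) ℂ)ᴴ) e f ∂(unitaryHaar r)

theorem integrable_conj_tensorPow (M : Matrix (Fin n → Fin r) (Fin n → Fin r) ℂ)
    (e f : Fin n → Fin r) :
    MeasureTheory.Integrable (fun U : Matrix.unitaryGroup (Fin r) ℂ =>
      (tensorPow n (U : Matrix (Fin r) (Fin r) ℂ) * M *
        tensorPow n (U : Matrix (Fin r) (Fin r) ℂ)ᴴ) e f) (unitaryHaar r) := by
  have hentry : ∀ a b, Continuous fun U : Matrix.unitaryGroup (Fin r) ℂ =>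
      (U : Matrix (Fin r) (Fin r) ℂ) a b := fun a b =>
    (continuous_apply_apply a b).comp continuous_subtype_val
  have hc : Continuous (fun U : Matrix.unitaryGroup (Fin r) ℂ =>
      (tensorPow n (U : Matrix (Fin r) (Fin r) ℂ) * M *
        tensorPow n (U : Matrix (Fin r) (Fin r) ℂ)ᴴ) e f) := by
    simp only [Matrix.mul_apply, tensorPow, Matrix.of_apply, Matrix.conjTranspose_apply]
    refine continuous_finsetSum _ fun a _ => (continuous_finsetSum _ fun b _ => ?_).mul ?_
    · exact (continuous_finsetProd _ fun k _ => hentry _ _).mul continuous_const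
    · exact continuous_finsetProd _ fun k _ => (hentry _ _).star
  exact hc.integrable_of_hasCompactSupport (HasCompactSupport.of_compactSpace _)

theorem map_twirl (L : Matrix (Fin n → Fin r) (Fin n → Fin r) ℂ →ₗ[ℂ] ℂ)
    (M : Matrix (Fin n → Fin r) (Fin n → Fin r) ℂ) :
    L (twirl M) = ∫ U : Matrix.unitaryGroup (Fin r) ℂ,
      L (tensorPow n (U : Matrix (Fin r) (Fin r) ℂ) * M *
        tensorPow n (U : Matrix (Fin r) (Fin r) ℂ)ᴴ) ∂(unitaryHaar r) := by
  have hL : ∀ N, L N = ∑ e, ∑ f, N e f * L (Matrix.single e f 1) := by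
    intro N
    conv_lhs => rw [Matrix.matrix_eq_sum_single N]
    simp only [map_sum]
    refine Finset.sum_congr rfl fun e _ => Finset.sum_congr rfl fun f _ => ?_
    rw [← smul_eq_mul, ← map_smul, Matrix.smul_single, smul_eq_mul, mul_one]
  rw [hL, MeasureTheory.integral_congr_ae (Filter.Eventually.of_forall fun U => hL _),
    MeasureTheory.integral_finsetSum _ fun e _ => MeasureTheory.integrable_finsetSum _ fun f _ =>
      (integrable_conj_tensorPow M e f).mul_const _]
  refine Finset.sum_congr rfl fun e _ => ?_
  rw [MeasureTheory.integral_finsetSum _ fun f _ =>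
      (integrable_conj_tensorPow M e f).mul_const _]
  refine Finset.sum_congr rfl fun f _ => ?_
  rw [MeasureTheory.integral_mul_const]
  rfl

theorem tensorPow_mul_conjTranspose_of_mem {U : Matrix (Fin r) (Fin r) ℂ}
    (hU : U ∈ Matrix.unitaryGroup (Fin r) ℂ) :
    tensorPow n Uᴴ * tensorPow n U = 1 := by
  rw [← tensorPow_mul, ← Matrix.star_eq_conjTranspose, Matrix.mem_unitaryGroup_iff'.1 hU,
    tensorPow_one]

/-- Conjugation by `W^{⊗n}` replaces `U` by `W U` in the integrand, and Haar measure is left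
invariant. -/
theorem commute_twirl (M : Matrix (Fin n → Fin r) (Fin n → Fin r) ℂ)
    (W : Matrix (Fin r) (Fin r) ℂ) (hW : W ∈ Matrix.unitaryGroup (Fin r) ℂ) :
    Commute (twirl M) (tensorPow n W) := by
  have h : tensorPow n W * twirl M * tensorPow n Wᴴ = twirl M := by
    ext e f
    have h1 := map_twirl (Matrix.entryLinearMap ℂ ℂ e f ∘ₗ LinearMap.mulRight ℂ (tensorPow n Wᴴ) ∘ₗ
      LinearMap.mulLeft ℂ (tensorPow n W)) M
    simp only [LinearMap.comp_apply, LinearMap.mulLeft_apply, LinearMap.mulRight_apply,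
      Matrix.entryLinearMap_apply] at h1
    rw [h1]
    refine Eq.trans ?_ (MeasureTheory.integral_mul_left_eq_self
      (fun U : Matrix.unitaryGroup (Fin r) ℂ => (tensorPow n (U : Matrix (Fin r) (Fin r) ℂ) * M *
        tensorPow n (U : Matrix (Fin r) (Fin r) ℂ)ᴴ) e f) ⟨W, hW⟩)
    congr 1
    ext U
    simp only [Submonoid.coe_mul, Matrix.conjTranspose_mul, tensorPow_mul, mul_assoc]
  rw [Commute, SemiconjBy]
  conv_lhs => rw [← h]
  rw [mul_assoc, tensorPow_mul_conjTranspose_of_mem hW, mul_one]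

/-- Permutations commute with `U^{⊗n}`, so by cyclicity of the trace the integrand is constant. -/
theorem trace_permUnitary_mul_twirl (M : Matrix (Fin n → Fin r) (Fin n → Fin r) ℂ)
    (σ : Equiv.Perm (Fin n)) :
    ((permUnitary (Fin r) σ)ᴴ * twirl M).trace = ((permUnitary (Fin r) σ)ᴴ * M).trace := by
  have h1 := map_twirl (Matrix.traceLinearMap (Fin n → Fin r) ℂ ℂ ∘ₗ
    LinearMap.mulLeft ℂ (permUnitary (Fin r) σ)ᴴ) M
  simp only [LinearMap.comp_apply, LinearMap.mulLeft_apply, Matrix.traceLinearMap_apply] at h1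
  rw [h1]
  have h2 : ∀ U : Matrix.unitaryGroup (Fin r) ℂ, ((permUnitary (Fin r) σ)ᴴ *
      (tensorPow n (U : Matrix (Fin r) (Fin r) ℂ) * M *
        tensorPow n (U : Matrix (Fin r) (Fin r) ℂ)ᴴ)).trace =
      ((permUnitary (Fin r) σ)ᴴ * M).trace := by
    intro U
    rw [← mul_assoc, ← mul_assoc, conjTranspose_permUnitary, permUnitary_mul_tensorPow,
      Matrix.trace_mul_comm, mul_assoc, ← mul_assoc, tensorPow_mul_conjTranspose_of_mem U.2,
      one_mul]
  simp [h2]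

/-- The Weingarten formula for the twirl. -/
theorem twirl_eq (M : Matrix (Fin n → Fin r) (Fin n → Fin r) ℂ) :
    twirl M = (∑ σ : Equiv.Perm (Fin n),
      ((permUnitary (Fin r) σ)ᴴ * M).trace • permUnitary (Fin r) σ) *
      ∑ lam : n.Partition with lam.parts.card ≤ r,
        ((1 / (n ! : ℂ)) * ((dimSpecht lam : ℂ) / (dimWeyl r lam : ℂ))) •
          isotypicProjector r lam := by
  have h := mul_gram_eq (commute_twirl M)
  simp only [trace_permUnitary_mul_twirl] at h
  rw [← h, mul_assoc, gram_mul_weingarten, mul_one]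

end Twirl

/-! ### The random Stinespring isometry -/

section Stinespring

variable {A B E : Type*} {n : ℕ}

theorem tensorPow_one_kronecker_apply [DecidableEq B] (U : Matrix E E ℂ)
    (b b' : Fin n → B) (e e' : Fin n → E) :
    tensorPow n ((1 : Matrix B B ℂ) ⊗ₖ U) (fun k => (b k, e k)) (fun k => (b' k, e' k)) =
      if b = b' then tensorPow n U e e' else 0 := by
  have h := congrFun (congrFun (tensorPow_one (ι := B) (n := n)) b) b'
  simp only [tensorPow, Matrix.of_apply] at h
  simp only [tensorPow, Matrix.of_apply, Matrix.kroneckerMap_apply, Finset.prod_mul_distrib, h]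
  simp only [Matrix.one_apply, ite_mul, one_mul, zero_mul]

variable [Fintype B] [Fintype E]

theorem sum_prod_pi {M : Type*} [AddCommMonoid M] (F : (Fin n → B × E) → M) :
    ∑ x, F x = ∑ b : Fin n → B, ∑ e : Fin n → E, F fun k => (b k, e k) := by
  rw [← Fintype.sum_prod_type', ← Equiv.sum_comp (Equiv.arrowProdEquivProdArrow (Fin n) _ _)]
  rfl

/-- The operator on the environments between the basis states `b` and `c` of the outputs. -/
def envBlock (N : Matrix (Fin n → B × E) (Fin n → B × E) ℂ) (b c : Fin n → B) :
    Matrix (Fin n → E) (Fin n → E) ℂ :=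
  Matrix.of fun e f => N (fun k => (b k, e k)) fun k => (c k, f k)

theorem tensorPow_one_kronecker_conj_apply [DecidableEq B] (U W : Matrix E E ℂ)
    (N : Matrix (Fin n → B × E) (Fin n → B × E) ℂ) (b c : Fin n → B) (e f : Fin n → E) :
    (tensorPow n ((1 : Matrix B B ℂ) ⊗ₖ U) * N * tensorPow n ((1 : Matrix B B ℂ) ⊗ₖ W))
      (fun k => (b k, e k)) (fun k => (c k, f k)) =
    (tensorPow n U * envBlock N b c * tensorPow n W) e f := by
  simp only [Matrix.mul_apply, sum_prod_pi, tensorPow_one_kronecker_apply, ite_mul, zero_mul,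
    mul_ite, mul_zero, envBlock, Matrix.of_apply]
  simp [Finset.sum_ite_irrel, Finset.sum_ite_eq, Finset.sum_ite_eq']

variable [Fintype A] [DecidableEq A]

theorem channelPow_apply {V : Matrix (B × E) A ℂ} {Φ : Matrix A A ℂ →ₗ[ℂ] Matrix B B ℂ}
    (hV : IsStinespringIsometry V Φ) (Y : Matrix (Fin n → A) (Fin n → A) ℂ) (b c : Fin n → B) :
    channelPow n Φ Y b c = ∑ e : Fin n → E, (tensorPow n V * Y * tensorPow n Vᴴ)
      (fun k => (b k, e k)) (fun k => (c k, e k)) := by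
  have hΦ : ∀ a a' b c, Φ (Matrix.single a a' 1) b c =
      ∑ e, V (b, e) a * star (V (c, e) a') := by
    intro a a' b c
    rw [hV.2, traceRight, Matrix.of_apply]
    refine Finset.sum_congr rfl fun e _ => ?_
    simp [Matrix.mul_apply, Matrix.single_apply, ite_and, Finset.sum_ite_eq]
  change ∑ a, ∑ a', Y a a' * ∏ k, Φ (Matrix.single (a k) (a' k) 1) (b k) (c k) = _
  simp only [hΦ, Finset.prod_univ_sum, Fintype.piFinset_univ, Finset.mul_sum, Matrix.mul_apply,
    Finset.sum_mul, tensorPow, Matrix.of_apply, Matrix.conjTranspose_apply,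
    Finset.prod_mul_distrib]
  rw [Finset.sum_comm]
  simp only [Finset.sum_comm (γ := Fin n → E)]
  refine Finset.sum_congr rfl fun e _ => Finset.sum_congr rfl fun a _ =>
    Finset.sum_congr rfl fun a' _ => ?_
  ring

/-- Moving `U_σ†` through `V^{⊗n}` permutes the `B` and `E` factors together. The outer `U_σ` undoes
the permutation on `B`, leaving `U_σ†` on the environment under the trace. -/
theorem permUnitary_mul_channelPow_apply [DecidableEq B] [DecidableEq E]
    {V : Matrix (B × E) A ℂ} {Φ : Matrix A A ℂ →ₗ[ℂ] Matrix B B ℂ}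
    (hV : IsStinespringIsometry V Φ) (X : Matrix (Fin n → A) (Fin n → A) ℂ)
    (σ : Equiv.Perm (Fin n)) (b c : Fin n → B) :
    (permUnitary B σ * channelPow n Φ ((permUnitary A σ)ᴴ * X)) b c =
      ((permUnitary E σ)ᴴ * envBlock (tensorPow n V * X * tensorPow n Vᴴ) b c).trace := by
  rw [permUnitary_mul_apply, channelPow_apply hV, conjTranspose_permUnitary,
    conjTranspose_permUnitary, ← Matrix.mul_assoc (tensorPow n V), ← permUnitary_mul_tensorPow,
    Matrix.mul_assoc, Matrix.mul_assoc, Matrix.trace]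
  refine Finset.sum_congr rfl fun e _ => ?_
  rw [permUnitary_mul_apply, Matrix.diag_apply, permUnitary_mul_apply, envBlock, Matrix.of_apply,
    Matrix.mul_assoc]
  have h : (fun k => ((b ∘ ⇑σ) k, e k)) ∘ ⇑σ⁻¹ = fun k => (b k, (e ∘ ⇑σ⁻¹) k) := by
    ext k <;> simp
  rw [h]

end Stinespring

end RandomStinespring
end

/-! ### The explicit formula, block by block -/

theorem mainTheorem5 (n dA dB r : ℕ)
    (Φ : Matrix (Fin dA) (Fin dA) ℂ →ₗ[ℂ] Matrix (Fin dB) (Fin dB) ℂ)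
    (V : Matrix (Fin dB × Fin r) (Fin dA) ℂ)
    (hV : RandomStinespring.IsStinespringIsometry V Φ)
    (X : Matrix (Fin n → Fin dA) (Fin n → Fin dA) ℂ) :
    RandomStinespring.randomStinespring n V X =
      ∑ σ : Equiv.Perm (Fin n),
        ∑ lam : n.Partition with lam.parts.card ≤ r,
          ((1 / (n ! : ℂ)) *
            ((RandomStinespring.dimSpecht lam : ℂ) / (RandomStinespring.dimWeyl r lam : ℂ))) •
          ((RandomStinespring.permUnitary (Fin dB) σ *
              RandomStinespring.channelPow n Φ
                ((RandomStinespring.permUnitary (Fin dA) σ)ᴴ * X)) ⊗ₖ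
            (RandomStinespring.permUnitary (Fin r) σ *
              RandomStinespring.isotypicProjector r lam)) := by
  open RandomStinespring in
  ext ⟨b, e⟩ ⟨c, f⟩
  have h1 : randomStinespring n V X (b, e) (c, f) =
      twirl (envBlock (tensorPow n V * X * tensorPow n Vᴴ) b c) e f := by
    -- Since `1 ⊗ U` acts only on the environment, the conjugation can be carried out inside each
    -- block.
    refine MeasureTheory.integral_congr_ae (Filter.Eventually.of_forall fun U => ?_)
    refine Eq.trans ?_ (tensorPow_one_kronecker_conj_apply (U : Matrix (Fin r) (Fin r) ℂ)
      (U : Matrix (Fin r) (Fin r) ℂ)ᴴ (tensorPow n V * X * tensorPow n Vᴴ) b c e f)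
    simp only [tensorPow_mul, Matrix.mul_assoc]
  rw [h1, twirl_eq, Finset.sum_mul]
  simp only [Finset.mul_sum, Matrix.sum_apply, Matrix.smul_apply, Matrix.kroneckerMap_apply,
    permUnitary_mul_channelPow_apply hV, smul_mul_assoc, mul_smul_comm, smul_eq_mul]
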